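/- \textbf{Setting.} Let $\mathcal I\subset\mathbb R$ be a nonempty open interval and $\{D_t\}_{t\in\mathcal I}$ Borel sets in $\mathbb R^d$ with $D_s\subseteq D_t$ for $s\le t$, $D_t=\bigcap_{s>t,\,s\in\mathcal I}D_s$ and $\bigcup_{t\in\mathcal I}D_t=\mathbb R^d$. Let $F_1,\dots,F_L$ (null distributions) and $G$ (distribution under false nulls) be probability distributions on $\mathbb R^d$ under which $\bigcap_{t\in\mathcal I}D_t$ has probability $0$. Let $a\in(0,1)$ and let $\boldsymbol\nu=(\nu_1,\dots,\nu_L)$ be a probability vector. The pairs $(\eta_i,X_i)$, $i\ge1$, are iid: $\eta_i=*$ with probability $a$ and $\eta_i=k$ with probability $(1-a)\nu_k$; given $\eta_i=*$, $X_i\sim G$, and given $\eta_i=k$, $X_i\sim F_k$. The null $H_i$ is true iff $\eta_i\ne *$. Let $\phi_k(t)=F_k(D_t)$ for $t\in\mathcal I$, $\phi_k(t)=0$ for $t\le\inf\mathcal I$, $\phi_k(t)=1$ for $t\ge\sup\mathcal I$; $\boldsymbol\phi=(\phi_1,\dots,\phi_L)$; $\Delta=\{\mathbf c\in[0,1]^L:\sum_k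 c_k\le1\}$; $s(x)=\inf\{t\in\mathcal I:x\in D_t\}$, $s_i=s(X_i)$; $R_n(t)=\#\{i\le n:X_i\in D_t\}$, $\mathbb F_n=R_n/n$; $Q(t)=(1-a)\boldsymbol\nu^\top\boldsymbol\phi(t)+aG(D_t)$. \textbf{Procedure.} Fix $\alpha\in(0,1)$, numbers $\epsilon_n\ge0$ and finite sets $\mathcal T_n\subset\mathcal I$. Let $\mathcal A_n$ be the set of $h\in C(\mathcal I)$ such that $h(s_i)\le\mathbb F_n(s_i)+\epsilon_n$ for all $i\le n$ and $\mathbb F_n(t_2)-\mathbb F_n(t_1)\ge h(t_2)-h(t_1)-\epsilon_n$ for all $t_1<t_2$ in $\mathcal T_n$. Let $M_n(t)=\sup\{\mathbf c^\top\boldsymbol\phi(t):\mathbf c\in\Delta,\ \mathbf c^\top\boldsymbol\phi\in\mathcal A_n\}$ and $\mathcal I_R=\{t\in\mathcal I: M_n(t)/\alpha\le (R_n(t)\vee1)/n\}$. If $\mathcal I_R\ne\emptyset$, let $\tau_n=\sup\mathcal I_R\in(-\infty,\infty]$ and reject $H_i$ ($i\le n$) iff $s_i\le\tau_n$; otherwise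 let $\tau_n=\inf\mathcal I$ and reject nothing. With $R$ the number of rejected nulls and $V$ the number of rejected true nulls, $\mathrm{FDR}_n=E[V/(R\vee1)]$. \textbf{Limit objects.} Let $\mathcal A=\{h\in C(\mathcal I): Q-h\ge0\text{ is nondecreasing on }\mathcal I\}$, $m(t)=\sup\{\mathbf c^\top\boldsymbol\phi(t):\mathbf c\in\Delta,\ \mathbf c^\top\boldsymbol\phi\in\mathcal A\}$ and $t_*=\sup\{t\in\mathcal I:m(t)\le\alpha Q(t)\}$. \textbf{Theorem.} Suppose that 1) all $\phi_k$ are continuous on $\mathbb R$ and $\mathbf c^\top\boldsymbol\phi$ is strictly increasing on $\mathcal I$ for some $\mathbf c\in\Delta$; 2) $t\mapsto G(D_t)$ is continuous on $\mathcal I$; 3) as $n\to\infty$, $\epsilon_n\to0$, $n\epsilon_n^2\to\infty$, and $\mathcal T_n$ is increasingly dense in $\mathcal I$, i.e. $\sup_{s\in\mathcal I\cap[-r,r]}\inf_{t\in\mathcal T_n}|s-t|\to0$ for every $r>0$; 4) (Assumption A) $t_*\in\mathcal I$, and there is $t_0<t_*$ such that $m(t)<\alpha Q(t)$ for all $t\in(t_0,t_*)\cap\mathcal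 I$. Then $V/(R\vee1)$ is integrable for every $n$ and $\limsup_{n\to\infty}\mathrm{FDR}_n\le\alpha$. Furthermore, the procedure is asymptotically equivalent to the one that rejects $H_i$ iff $s_i\le t_*$: $\tau_n\to t_*$ in probability, and the number of $i\le n$ on which the two procedures decide differently, divided by $\#\{i\le n:s_i\le t_*\}\vee1$, tends to $0$ in probability. -/

import Mathlib

open MeasureTheory ProbabilityTheory Filter Topology

namespace CompositeNull

/-- The observation space `ℝ^d`. -/
abbrev Obs (d : ℕ) : Type := EuclideanSpace ℝ (Fin d)

/-- An increasing, right-continuous family of Borel sets `D t`, `t ∈ I`, exhausting `ℝ^d`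
(conditions D1 and D2). Values of `D` outside `I` are irrelevant. -/
structure IsRegionFamily {d : ℕ} (I : Set ℝ) (D : ℝ → Set (Obs d)) : Prop where
  measurableSet : ∀ t ∈ I, MeasurableSet (D t)
  mono : ∀ s ∈ I, ∀ t ∈ I, s ≤ t → D s ⊆ D t
  rightCont : ∀ t ∈ I, D t = ⋂ s ∈ {s | s ∈ I ∧ t < s}, D s
  exhaust : ⋃ t ∈ I, D t = Set.univ

/-- The significance level `t ↦ P (D t)` on `I`, extended by `0` to the left of the interval `I`
and by `1` to its right. -/
noncomputable def level {d : ℕ} (I : Set ℝ) (D : ℝ → Set (Obs d)) (P : Measure (Obs d))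
    (t : ℝ) : ℝ :=
  open Classical in
  if t ∈ I then P.real (D t) else if ∀ s ∈ I, t ≤ s then 0 else 1

/-- `Δ = {c ∈ [0,1]^L : c_1 + ⋯ + c_L ≤ 1}`. -/
def Delta (L : ℕ) : Set (Fin L → ℝ) :=
  {c | (∀ k, c k ∈ Set.Icc (0 : ℝ) 1) ∧ ∑ k, c k ≤ 1}

/-- The function `cᵀφ`, where `φ_k` is the significance level under the null `F k`. -/
noncomputable def comb {d L : ℕ} (I : Set ℝ) (D : ℝ → Set (Obs d))
    (F : Fin L → Measure (Obs d)) (c : Fin L → ℝ) (t : ℝ) : ℝ :=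
  ∑ k, c k * level I D (F k) t

/-- `Q(t) = (1 - a) νᵀφ(t) + a G(D_t)`. -/
noncomputable def popCdf {d L : ℕ} (I : Set ℝ) (D : ℝ → Set (Obs d))
    (F : Fin L → Measure (Obs d)) (G : Measure (Obs d)) (ν : Fin L → ℝ) (a t : ℝ) : ℝ :=
  (1 - a) * comb I D F ν t + a * level I D G t

/-- `s(x) = inf {t ∈ I : x ∈ D_t}`. (The set is nonempty; when it is not bounded below, `x` lies
in `⋂ t ∈ I, D t`, a null set of all the distributions considered.) -/
noncomputable def score {d : ℕ} (I : Set ℝ) (D : ℝ → Set (Obs d)) (x : Obs d) : ℝ :=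
  sInf {t | t ∈ I ∧ x ∈ D t}

/-! ### The random mixture model

The identity of an observation is `Sum.inl k` (the `k`-th null distribution) or `Sum.inr ()`
(a false null). -/

/-- The joint law of `(η_i, X_i)`: the identity is a false null with probability `a` and the
`k`-th null with probability `(1 - a) ν_k`; given the identity, the observation is drawn from `G`,
respectively from `F k`. -/
noncomputable def mixtureLaw {d L : ℕ} (F : Fin L → Measure (Obs d)) (G : Measure (Obs d))
    (ν : Fin L → ℝ) (a : ℝ) : Measure ((Fin L ⊕ Unit) × Obs d) :=
  ENNReal.ofReal a • (Measure.dirac (Sum.inr ())).prod G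
    + ∑ k, ENNReal.ofReal ((1 - a) * ν k) • (Measure.dirac (Sum.inl k)).prod (F k)

/-- The pairs `(η_i, X_i)`, `i = 0, 1, 2, …`, are iid from the mixture model. -/
structure IsMixtureSample {Ω : Type*} [MeasurableSpace Ω] {d L : ℕ} (P : Measure Ω)
    (F : Fin L → Measure (Obs d)) (G : Measure (Obs d)) (ν : Fin L → ℝ) (a : ℝ)
    (η : ℕ → Ω → Fin L ⊕ Unit) (X : ℕ → Ω → Obs d) : Prop where
  measurable_id : ∀ i, Measurable (η i)
  measurable_obs : ∀ i, Measurable (X i)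
  law : ∀ i, P.map (fun ω => (η i ω, X i ω)) = mixtureLaw F G ν a
  indep : iIndepFun (fun i ω => (η i ω, X i ω)) P

/-! ### The procedure on realized data `x 0, …, x (n - 1)` -/

/-- `R_n(t) = #{i < n : x_i ∈ D_t}`. -/
noncomputable def countIn {d : ℕ} (D : ℝ → Set (Obs d)) (x : ℕ → Obs d) (n : ℕ) (t : ℝ) : ℕ :=
  open Classical in ((Finset.range n).filter fun i => x i ∈ D t).card

/-- `𝔽_n(t) = R_n(t) / n`. -/
noncomputable def empCdf {d : ℕ} (D : ℝ → Set (Obs d)) (x : ℕ → Obs d) (n : ℕ) (t : ℝ) : ℝ :=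
  (countIn D x n t : ℝ) / n

/-- The data-dependent family `𝒜_n` with margin `e` and grid `T`. -/
def dataFamily {d : ℕ} (I : Set ℝ) (D : ℝ → Set (Obs d)) (e : ℝ) (T : Finset ℝ)
    (x : ℕ → Obs d) (n : ℕ) : Set (ℝ → ℝ) :=
  {h | ContinuousOn h I ∧
    (∀ i < n, h (score I D (x i)) ≤ empCdf D x n (score I D (x i)) + e) ∧
    ∀ t₁ ∈ T, ∀ t₂ ∈ T, t₁ < t₂ → h t₂ - h t₁ - e ≤ empCdf D x n t₂ - empCdf D x n t₁}

/-- `M_n(t) = sup {cᵀφ(t) : c ∈ Δ, cᵀφ ∈ 𝒜_n}`. -/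
noncomputable def dataMax {d L : ℕ} (I : Set ℝ) (D : ℝ → Set (Obs d))
    (F : Fin L → Measure (Obs d)) (e : ℝ) (T : Finset ℝ) (x : ℕ → Obs d) (n : ℕ) (t : ℝ) : ℝ :=
  sSup {y | ∃ c ∈ Delta L, comb I D F c ∈ dataFamily I D e T x n ∧ y = comb I D F c t}

/-- `I_R = {t ∈ I : M_n(t) / α ≤ (R_n(t) ∨ 1) / n}`. -/
def candidates {d L : ℕ} (I : Set ℝ) (D : ℝ → Set (Obs d)) (F : Fin L → Measure (Obs d))
    (α e : ℝ) (T : Finset ℝ) (x : ℕ → Obs d) (n : ℕ) : Set ℝ :=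
  {t | t ∈ I ∧ dataMax I D F e T x n t / α ≤ ((max (countIn D x n t) 1 : ℕ) : ℝ) / n}

/-- The cutoff `τ`, with values in the extended reals: `sup I_R` if `I_R` is nonempty,
`inf I` otherwise. -/
noncomputable def cutoff {d L : ℕ} (I : Set ℝ) (D : ℝ → Set (Obs d))
    (F : Fin L → Measure (Obs d)) (α e : ℝ) (T : Finset ℝ) (x : ℕ → Obs d) (n : ℕ) : EReal :=
  open Classical in
  if (candidates I D F α e T x n).Nonempty then
    sSup ((fun t : ℝ => (t : EReal)) '' candidates I D F α e T x n)
  else sInf ((fun t : ℝ => (t : EReal)) '' I)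

/-- The set of indices `i < n` of the hypotheses rejected by the procedure. -/
noncomputable def rejected {d L : ℕ} (I : Set ℝ) (D : ℝ → Set (Obs d))
    (F : Fin L → Measure (Obs d)) (α e : ℝ) (T : Finset ℝ) (x : ℕ → Obs d) (n : ℕ) : Finset ℕ :=
  open Classical in
  (Finset.range n).filter fun i =>
    (candidates I D F α e T x n).Nonempty ∧
      ((score I D (x i) : ℝ) : EReal) ≤ cutoff I D F α e T x n

/-- The set of indices `i < n` with `s_i ≤ u`, for a fixed threshold `u`. -/
noncomputable def rejectedAt {d : ℕ} (I : Set ℝ) (D : ℝ → Set (Obs d)) (u : ℝ)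
    (x : ℕ → Obs d) (n : ℕ) : Finset ℕ :=
  open Classical in (Finset.range n).filter fun i => score I D (x i) ≤ u

/-- The false discovery proportion `V / (R ∨ 1)` of a set `S` of rejected hypotheses, where `V` is
the number of true nulls in `S` and `R` the number of elements of `S`. -/
noncomputable def fdp {L : ℕ} (lab : ℕ → Fin L ⊕ Unit) (S : Finset ℕ) : ℝ :=
  ((S.filter fun i => (lab i).isLeft).card : ℝ) / ((max S.card 1 : ℕ) : ℝ)

/-! ### The limit objects -/

/-- `𝒜 = {h ∈ C(I) : Q - h ≥ 0 is nondecreasing}`. -/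
def limitFamily (I : Set ℝ) (Q : ℝ → ℝ) : Set (ℝ → ℝ) :=
  {h | ContinuousOn h I ∧ (∀ t ∈ I, 0 ≤ Q t - h t) ∧ MonotoneOn (fun t => Q t - h t) I}

/-- `m(t) = sup {cᵀφ(t) : c ∈ Δ, cᵀφ ∈ 𝒜}`. -/
noncomputable def limitMax {d L : ℕ} (I : Set ℝ) (D : ℝ → Set (Obs d))
    (F : Fin L → Measure (Obs d)) (G : Measure (Obs d)) (ν : Fin L → ℝ) (a t : ℝ) : ℝ :=
  sSup {y | ∃ c ∈ Delta L, comb I D F c ∈ limitFamily I (popCdf I D F G ν a) ∧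
    y = comb I D F c t}

/-- `δ(S, T) = sup {d(s, S) : s ∈ T}`, in `[0, ∞]`. -/
noncomputable def excess (S T : Set ℝ) : ENNReal := ⨆ s ∈ T, Metric.infEDist s S

/-- The finite sets `S n` are increasingly dense in `T`. -/
def IncreasinglyDense (S : ℕ → Finset ℝ) (T : Set ℝ) : Prop :=
  ∀ r : ℝ, 0 < r → Tendsto (fun n => excess (S n : Set ℝ) (T ∩ Set.Icc (-r) r)) atTop (𝓝 0)

end CompositeNull

/-! Everything is read off one event, `IsTypical`: the empirical distribution is within a fixed
multiple of `ε n` of `Q`, uniformly on `I`. Its probability tends to one because the uniform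
deviation is of order `n ^ (-1/2)` (`measure_deviation_le`) while `n * ε n ^ 2 → ∞`. That rate comes
from Kolmogorov's maximal inequality: along an increasing chain of sets `B t`, the centered count
divided by `1 - μ (B t)` behaves like a martingale in `t` (`maximal_centeredCount`).

On the typical event the margin makes every member of the limit family feasible, so `M_n ≥ m`.
Conversely, a feasible `c` nearly satisfies the increment constraints on a dense grid, and
compactness of `Delta L` then forces it close to the limit set (`eventually_close`), so `M_n ≤ m +
δ` on all of `I`. By Assumption A, points just to the left of `t_*` become candidates. To the right
of `t_*` one has `m > α Q`; this gap is uniform on compact intervals, but compactness says nothing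
near the right end of `I`. There part of the margin is spent on mixing `c` with `ν`, which raises
`M_n` by more than the sampling error. Hence the cutoff lies between two points arbitrarily close to
`t_*` on either side (`eventually_cutoff_mem`).

The rejected set is thus squeezed between the observations in `D t₁` and those in `D t₂`. The
true-null part `(1 - a) ν` of the mixture belongs to the limit family, so `(1 - a) νᵀφ ≤ α Q` where
the criterion holds, and by continuity at `t_*`. Concentration of the counts and continuity of `Q`
and `νᵀφ` turn this into the bound on the false discovery rate. The same squeeze gives the
equivalence with the threshold rule.

Integrability needs its own argument, since `M_n` is a supremum over a random set: rejection depends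
only on which scores are candidates, and these are measurable events off a null set. -/

namespace CompositeNull

/-! ### Kolmogorov's maximal inequality. -/

section MaximalInequality

variable {Ω ι : Type*} [LinearOrder ι]

/-- The event that `t` is the first index of `S` at which `|M t|` reaches `x`. -/
def firstHit (S : Finset ι) (M : ι → Ω → ℝ) (x : ℝ) (t : ι) : Set Ω :=
  {ω | x ≤ |M t ω| ∧ ∀ u ∈ S, u < t → |M u ω| < x}

lemma measurableSet_firstHit [MeasurableSpace Ω] (S : Finset ι) {M : ι → Ω → ℝ}
    (hM : ∀ t, Measurable (M t)) (x : ℝ) (t : ι) : MeasurableSet (firstHit S M x t) := by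
  have : firstHit S M x t = {ω | x ≤ |M t ω|} ∩ ⋂ u ∈ S, ⋂ (_ : u < t), {ω | |M u ω| < x} := by
    ext ω
    simp [firstHit]
  rw [this]
  refine (measurableSet_le measurable_const (hM t).abs).inter ?_
  refine Finset.measurableSet_biInter _ fun u _ => MeasurableSet.iInter fun _ => ?_
  exact measurableSet_lt (hM u).abs measurable_const

lemma exists_firstHit {S : Finset ι} {M : ι → Ω → ℝ} {x : ℝ} {ω : Ω} (h : ∃ t ∈ S, x ≤ |M t ω|) :
    ∃ t ∈ S, ω ∈ firstHit S M x t := by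
  classical
  obtain ⟨t, ht, hx⟩ := h
  have hne : (S.filter fun t => x ≤ |M t ω|).Nonempty := ⟨t, by simp [ht, hx]⟩
  obtain ⟨h1, h2⟩ := Finset.mem_filter.1 (Finset.min'_mem _ hne)
  refine ⟨(S.filter fun t => x ≤ |M t ω|).min' hne, h1, h2, fun u hu hlt => ?_⟩
  by_contra hcon
  have hmem : u ∈ S.filter fun t => x ≤ |M t ω| := Finset.mem_filter.2 ⟨hu, not_lt.1 hcon⟩
  exact absurd (Finset.min'_le _ u hmem) (not_le.2 hlt)

lemma firstHit_unique {S : Finset ι} {M : ι → Ω → ℝ} {x : ℝ} {ω : Ω} {t u : ι} (ht : t ∈ S)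
    (hu : u ∈ S) (h1 : ω ∈ firstHit S M x t) (h2 : ω ∈ firstHit S M x u) : t = u := by
  rcases lt_trichotomy t u with h | h | h
  · exact absurd h1.1 (not_le.2 (h2.2 t ht h))
  · exact h
  · exact absurd h2.1 (not_le.2 (h1.2 u hu h))

/-- Kolmogorov's maximal inequality, for processes whose increments up to the last time are
orthogonal to the first hitting events. -/
lemma maximal_inequality [MeasurableSpace Ω] {P : Measure Ω} [IsProbabilityMeasure P]
    {S : Finset ι} {M : ι → Ω → ℝ} (hM : ∀ t, Measurable (M t)) {C : ℝ}
    (hC : ∀ t ω, |M t ω| ≤ C) {x : ℝ} (hx : 0 ≤ x) {N : ι}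
    (horth : ∀ t ∈ S, ∫ ω, ((firstHit S M x t).indicator (fun _ => (1 : ℝ)) ω * M t ω) *
      (M N ω - M t ω) ∂P = 0) :
    x ^ 2 * P.real {ω | ∃ t ∈ S, x ≤ |M t ω|} ≤ ∫ ω, M N ω ^ 2 ∂P := by
  classical
  set A := firstHit S M x with hA
  have hAm : ∀ t, MeasurableSet (A t) := measurableSet_firstHit S hM x
  set J : ι → Ω → ℝ := fun t => (A t).indicator fun _ => (1 : ℝ) with hJ
  have hJm : ∀ t, Measurable (J t) := fun t => measurable_const.indicator (hAm t)
  have hJ01 : ∀ t ω, J t ω = 0 ∨ J t ω = 1 := by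
    intro t ω
    by_cases h : ω ∈ A t <;> simp [hJ, h]
  have hint : ∀ t s u, Integrable (fun ω => J t ω * M s ω * M u ω) P := by
    intro t s u
    refine Integrable.of_bound (((hJm t).mul (hM s)).mul (hM u)).aestronglyMeasurable (C * C) ?_
    refine ae_of_all _ fun ω => ?_
    have h1 : |J t ω| ≤ 1 := by rcases hJ01 t ω with h | h <;> simp [h]
    have hC0 : 0 ≤ C := (abs_nonneg _).trans (hC t ω)
    rw [Real.norm_eq_abs, abs_mul, abs_mul]
    have : |J t ω| * |M s ω| ≤ 1 * C :=
      mul_le_mul h1 (hC s ω) (abs_nonneg _) zero_le_one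
    nlinarith [hC u ω, abs_nonneg (M u ω), abs_nonneg (M s ω), abs_nonneg (J t ω)]
  have hNint : Integrable (fun ω => M N ω ^ 2) P := by
    refine Integrable.of_bound ((hM N).pow_const 2).aestronglyMeasurable (C ^ 2) ?_
    refine ae_of_all _ fun ω => ?_
    rw [Real.norm_eq_abs, abs_pow]
    exact pow_le_pow_left₀ (abs_nonneg _) (hC N ω) 2
  have hstep : ∀ t ∈ S, x ^ 2 * P.real (A t) ≤ ∫ ω, J t ω * M N ω * M N ω ∂P := by
    intro t ht
    have e1 : x ^ 2 * P.real (A t) ≤ ∫ ω, J t ω * M t ω * M t ω ∂P := by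
      have : x ^ 2 * P.real (A t) = ∫ ω, x ^ 2 * J t ω ∂P := by
        rw [integral_const_mul, hJ, integral_indicator_const _ (hAm t)]
        simp
      rw [this]
      refine integral_mono (((integrable_const _).indicator (hAm t)).const_mul _) (hint t t t) ?_
      intro ω
      by_cases h : ω ∈ A t
      · have : x ≤ |M t ω| := h.1
        have h2 : x ^ 2 ≤ M t ω ^ 2 := by
          rw [← sq_abs (M t ω)]
          exact pow_le_pow_left₀ hx this 2
        simpa [hJ, h, ← sq] using h2
      · simp [hJ, h]
    have e2 : ∫ ω, J t ω * M t ω * (M N ω - M t ω) ∂P = 0 := horth t ht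
    -- The two integrands differ by `J t * (M N - M t) ^ 2 ≥ 0`, and the cross term integrates to
    -- zero by orthogonality.
    have e3 : ∫ ω, (J t ω * M t ω * M t ω + 2 * (J t ω * M t ω * (M N ω - M t ω))) ∂P
        ≤ ∫ ω, J t ω * M N ω * M N ω ∂P := by
      have hi : Integrable (fun ω => J t ω * M t ω * (M N ω - M t ω)) P := by
        simpa only [mul_sub] using! (hint t t N).sub (hint t t t)
      refine integral_mono ((hint t t t).add (hi.const_mul 2)) (hint t N N) fun ω => ?_
      have : 0 ≤ J t ω := by rcases hJ01 t ω with h | h <;> simp [h]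
      have h2 := mul_nonneg this (sq_nonneg (M N ω - M t ω))
      show J t ω * M t ω * M t ω + 2 * (J t ω * M t ω * (M N ω - M t ω)) ≤ J t ω * M N ω * M N ω
      nlinarith
    have hi : Integrable (fun ω => J t ω * M t ω * (M N ω - M t ω)) P := by
      simpa only [mul_sub] using! (hint t t N).sub (hint t t t)
    rw [integral_add (hint t t t) (hi.const_mul 2), integral_const_mul, e2] at e3
    linarith
  calc x ^ 2 * P.real {ω | ∃ t ∈ S, x ≤ |M t ω|}
      ≤ x ^ 2 * ∑ t ∈ S, P.real (A t) := by
        gcongr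
        refine le_trans (measureReal_mono ?_ (measure_ne_top _ _))
          (measureReal_biUnion_finset_le S A)
        intro ω hω
        obtain ⟨t, ht, h⟩ := exists_firstHit hω
        exact Set.mem_biUnion ht h
    _ = ∑ t ∈ S, x ^ 2 * P.real (A t) := Finset.mul_sum _ _ _
    _ ≤ ∑ t ∈ S, ∫ ω, J t ω * M N ω * M N ω ∂P := Finset.sum_le_sum hstep
    _ = ∫ ω, ∑ t ∈ S, J t ω * M N ω * M N ω ∂P :=
        (integral_finsetSum _ fun t _ => hint t N N).symm
    _ ≤ ∫ ω, M N ω ^ 2 ∂P := by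
        refine integral_mono (integrable_finsetSum _ fun t _ => hint t N N) hNint fun ω => ?_
        show ∑ t ∈ S, J t ω * M N ω * M N ω ≤ M N ω ^ 2
        have hs : ∑ t ∈ S, J t ω ≤ 1 := by
          by_cases h : ∃ t ∈ S, ω ∈ A t
          · obtain ⟨t, ht, h⟩ := h
            rw [Finset.sum_eq_single_of_mem t ht]
            · simp [hJ, h]
            · intro u hu hne
              have : ω ∉ A u := fun h' => hne (firstHit_unique hu ht h' h)
              simp [hJ, this]
          · push Not at h
            rw [Finset.sum_eq_zero]
            · norm_num
            · intro t ht
              simp [hJ, h t ht]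
        have : ∑ t ∈ S, J t ω * M N ω * M N ω = (∑ t ∈ S, J t ω) * M N ω ^ 2 := by
          rw [Finset.sum_mul]
          exact Finset.sum_congr rfl fun t _ => by ring
        rw [this]
        nlinarith [sq_nonneg (M N ω)]

end MaximalInequality

/-! ### The empirical process over a chain of sets. -/

section Empirical

variable {Ω E ι : Type*} [MeasurableSpace Ω] [MeasurableSpace E] [LinearOrder ι]
  {P : Measure Ω} [IsProbabilityMeasure P] {μ : Measure E}
  {Z : ℕ → Ω → E}

/-- The number of `i < n` with `z i ∈ B`, centered under `μ`. -/
noncomputable def centeredCount (μ : Measure E) (n : ℕ) (B : Set E) (z : ℕ → E) : ℝ :=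
  ∑ i ∈ Finset.range n, (B.indicator (fun _ => (1 : ℝ)) (z i) - μ.real B)

lemma measurable_centeredCount (n : ℕ) {B : Set E} (hB : MeasurableSet B) :
    Measurable (centeredCount μ n B) := by
  refine Finset.measurable_fun_sum _ fun i _ => ?_
  exact ((measurable_const.indicator hB).comp (measurable_pi_apply i)).sub_const _

lemma abs_indicator_sub_le [IsProbabilityMeasure μ] (B : Set E) (e : E) :
    |B.indicator (fun _ => (1 : ℝ)) e - μ.real B| ≤ 1 := by
  have h0 : 0 ≤ μ.real B := measureReal_nonneg
  have h1 : μ.real B ≤ 1 := measureReal_le_one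
  by_cases h : e ∈ B <;> simp only [h, Set.indicator_of_mem, not_false_eq_true,
    Set.indicator_of_notMem] <;> rw [abs_le] <;> constructor <;> linarith

lemma abs_centeredCount_le [IsProbabilityMeasure μ] (n : ℕ) (B : Set E) (z : ℕ → E) :
    |centeredCount μ n B z| ≤ n := by
  refine (Finset.abs_sum_le_sum_abs _ _).trans ?_
  refine (Finset.sum_le_card_nsmul _ _ 1 fun i _ => abs_indicator_sub_le B (z i)).trans ?_
  simp

lemma integral_indicator_sub [IsProbabilityMeasure μ] {B : Set E} (hB : MeasurableSet B) :
    ∫ e, (B.indicator (fun _ => (1 : ℝ)) e - μ.real B) ∂μ = 0 := by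
  rw [integral_sub ((integrable_const _).indicator hB) (integrable_const _),
    integral_indicator_const _ hB]
  simp

/-- Orthogonality of a function of the sample that does not see where in the complement of `B` the
observations lie, and a sum of centered terms that vanish on `B`. -/
lemma integral_mul_sum_eq_zero (hZ : ∀ i, Measurable (Z i)) (hind : iIndepFun Z P)
    (hlaw : ∀ i, P.map (Z i) = μ) (n : ℕ) {B : Set E} {e₀ : E} {w : (ℕ → E) → ℝ}
    (hw : Measurable w) {C : ℝ} (hwC : ∀ z, |w z| ≤ C)
    (hloc : ∀ z z', (∀ l < n, z l = z' l) → w z = w z')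
    (hupd : ∀ z i, z i ∉ B → w (Function.update z i e₀) = w z)
    {y : E → ℝ} (hy : Measurable y) {K : ℝ} (hyK : ∀ e, |y e| ≤ K) (hyB : ∀ e ∈ B, y e = 0)
    (hy0 : ∫ e, y e ∂μ = 0) :
    ∫ ω, w (fun i => Z i ω) * ∑ i ∈ Finset.range n, y (Z i ω) ∂P = 0 := by
  classical
  have hZall : Measurable fun ω i => Z i ω := measurable_pi_lambda _ hZ
  have hint : ∀ i ∈ Finset.range n, Integrable (fun ω => w (fun i => Z i ω) * y (Z i ω)) P := by
    intro i _
    refine Integrable.of_bound ((hw.comp hZall).mul (hy.comp (hZ i))).aestronglyMeasurable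
      (C * K) (ae_of_all _ fun ω => ?_)
    rw [Real.norm_eq_abs, abs_mul]
    exact mul_le_mul (hwC _) (hyK _) (abs_nonneg _) ((abs_nonneg _).trans (hwC fun i => Z i ω))
  simp_rw [Finset.mul_sum]
  rw [integral_finsetSum _ hint]
  refine Finset.sum_eq_zero fun i hi => ?_
  let S := (Finset.range n).erase i
  let ext : ((l : S) → E) → ℕ → E := fun zS l => if h : l ∈ S then zS ⟨l, h⟩ else e₀
  have hext : Measurable ext := by
    refine measurable_pi_lambda _ fun l => ?_
    by_cases h : l ∈ S
    · simpa [ext, h] using measurable_pi_apply (⟨l, h⟩ : S)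
    · simp [ext, h]
  have hdisj : Disjoint S {i} := by simp [S]
  have hI := hind.indepFun_finset S {i} hdisj hZ
  have hI2 := hI.comp (hw.comp hext)
    (hy.comp (measurable_pi_apply (⟨i, Finset.mem_singleton_self i⟩ : ({i} : Finset ℕ))))
  -- Where `y (Z i) ≠ 0` the observation `Z i` lies outside `B`, so `w` does not change when it is
  -- replaced by `e₀`. The first factor then involves only the other observations and is independent
  -- of the second, which has mean zero.
  have key : ∀ ω, w (fun i => Z i ω) * y (Z i ω) =
      (w ∘ ext) (fun l : S => Z l ω) * y (Z i ω) := by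
    intro ω
    by_cases h : Z i ω ∈ B
    · simp [hyB _ h]
    · congr 1
      rw [← hupd (fun i => Z i ω) i h]
      refine hloc _ _ fun l hl => ?_
      by_cases hli : l = i
      · subst hli
        simp [ext, S]
      · simp [ext, S, hli, hl]
  simp_rw [key]
  have := hI2.integral_fun_mul_eq_mul_integral
    ((hw.comp hext).comp (measurable_pi_lambda _ fun l => hZ l)).aestronglyMeasurable
    ((hy.comp (hZ i))).aestronglyMeasurable
  refine this.trans ?_
  have h0 : ∫ ω, y (Z i ω) ∂P = 0 := by
    rw [← hy0, ← hlaw i, integral_map (hZ i).aemeasurable hy.aestronglyMeasurable]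
  simp only [Function.comp_def] at h0 ⊢
  rw [h0, mul_zero]

lemma integral_sq_centeredCount_le [IsProbabilityMeasure μ] (hZ : ∀ i, Measurable (Z i))
    (hind : iIndepFun Z P) (hlaw : ∀ i, P.map (Z i) = μ) (n : ℕ) {B : Set E}
    (hB : MeasurableSet B) :
    ∫ ω, centeredCount μ n B (fun i => Z i ω) ^ 2 ∂P ≤ n := by
  let f : E → ℝ := fun e => B.indicator (fun _ => (1 : ℝ)) e - μ.real B
  have hf : Measurable f := (measurable_const.indicator hB).sub_const _
  have hmem : ∀ i, MemLp (fun ω => f (Z i ω)) 2 P := fun i =>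
    MemLp.of_bound (hf.comp (hZ i)).aestronglyMeasurable 1
      (ae_of_all _ fun ω => abs_indicator_sub_le B (Z i ω))
  have hmean : ∀ i, ∫ ω, f (Z i ω) ∂P = 0 := fun i => by
    rw [← integral_indicator_sub (μ := μ) hB]
    have := integral_map (μ := P) (hZ i).aemeasurable (f := f) hf.aestronglyMeasurable
    rw [hlaw i] at this
    exact this.symm
  have hvar := IndepFun.variance_sum (X := fun i ω => f (Z i ω)) (s := Finset.range n)
    (fun i _ => hmem i) (fun i _ j _ hij => (hind.indepFun hij).comp hf hf)
  have hsum : (∑ i ∈ Finset.range n, fun ω => f (Z i ω)) =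
      fun ω => centeredCount μ n B (fun i => Z i ω) := by
    ext ω
    simp [centeredCount, f]
  have hcm : Measurable fun ω => centeredCount μ n B (fun i => Z i ω) :=
    (measurable_centeredCount n hB).comp (measurable_pi_lambda _ hZ)
  rw [hsum, variance_of_integral_eq_zero hcm.aemeasurable] at hvar
  · rw [hvar]
    refine (Finset.sum_le_card_nsmul _ _ 1 fun i _ => ?_).trans (by simp)
    have := variance_le_sq_of_bounded (μ := P) (a := -1) (b := 1) (X := fun ω => f (Z i ω))
      (ae_of_all _ fun ω => abs_le.1 (abs_indicator_sub_le B (Z i ω)))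
      (hf.comp (hZ i)).aemeasurable
    norm_num at this
    exact this
  · simp only [centeredCount]
    rw [integral_finsetSum _ fun i _ => (hmem i).integrable (by norm_num)]
    exact Finset.sum_eq_zero fun i _ => hmean i

/-- A maximal inequality for the empirical process over a chain of sets of measure at most `1/2`. -/
lemma maximal_centeredCount [IsProbabilityMeasure μ] (hZ : ∀ i, Measurable (Z i))
    (hind : iIndepFun Z P) (hlaw : ∀ i, P.map (Z i) = μ) (n : ℕ) {S : Finset ι} {B : ι → Set E}
    (hB : ∀ t ∈ S, MeasurableSet (B t)) (hmono : ∀ t ∈ S, ∀ u ∈ S, t ≤ u → B t ⊆ B u)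
    (hhalf : ∀ t ∈ S, μ.real (B t) ≤ 1 / 2) {x : ℝ} (hx : 0 ≤ x) :
    x ^ 2 * P.real {ω | ∃ t ∈ S, x ≤ |centeredCount μ n (B t) (fun i => Z i ω)|} ≤ 4 * n := by
  classical
  rcases S.eq_empty_or_nonempty with rfl | hS
  · simp
  have hZall : Measurable fun ω i => Z i ω := measurable_pi_lambda _ hZ
  let N := S.max' hS
  have hN : N ∈ S := S.max'_mem hS
  -- The normalization makes each summand equal to `1` on `B t`, whatever `t`. Increments in `t`
  -- therefore ignore the observations already caught. Off `S` the value `0` keeps every `m t`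
  -- measurable and bounded.
  let m : ι → (ℕ → E) → ℝ := fun t z =>
    if t ∈ S then centeredCount μ n (B t) z / (1 - μ.real (B t)) else 0
  let M : ι → Ω → ℝ := fun t ω => m t fun i => Z i ω
  have hm : ∀ t, Measurable (m t) := by
    intro t
    by_cases ht : t ∈ S
    · simpa [m, ht] using (measurable_centeredCount n (hB t ht)).div_const _
    · simp [m, ht]
  have hden : ∀ t ∈ S, 1 / 2 ≤ 1 - μ.real (B t) := fun t ht => by linarith [hhalf t ht]
  have hmC : ∀ t z, |m t z| ≤ 2 * n := by
    intro t z
    by_cases ht : t ∈ S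
    · have := hden t ht
      simp only [m, ht, if_true]
      rw [abs_div, abs_of_pos (show (0 : ℝ) < 1 - μ.real (B t) by linarith),
        div_le_iff₀ (by linarith)]
      have h1 := abs_centeredCount_le (μ := μ) n (B t) z
      nlinarith [abs_nonneg (centeredCount μ n (B t) z), (Nat.cast_nonneg n : (0 : ℝ) ≤ n)]
    · simp [m, ht]
  have hmax := maximal_inequality (P := P) (S := S) (M := M) (fun t => (hm t).comp hZall)
    (C := 2 * n) (fun t ω => hmC t _) hx (N := N) ?_
  · refine le_trans ?_ (hmax.trans ?_)
    · refine mul_le_mul_of_nonneg_left (measureReal_mono ?_ (measure_ne_top _ _)) (sq_nonneg _)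
      · rintro ω ⟨t, ht, h⟩
        refine ⟨t, ht, ?_⟩
        have := hden t ht
        simp only [M, m, ht, if_true]
        rw [abs_div, abs_of_pos (show (0 : ℝ) < 1 - μ.real (B t) by linarith),
          le_div_iff₀ (by linarith)]
        have : (0 : ℝ) ≤ μ.real (B t) := measureReal_nonneg
        nlinarith
    · have h1 := integral_sq_centeredCount_le hZ hind hlaw n (hB N hN)
      have h2 : ∀ ω, M N ω ^ 2 =
          (1 / (1 - μ.real (B N))) ^ 2 * centeredCount μ n (B N) (fun i => Z i ω) ^ 2 := by
        intro ω
        simp only [M, m, hN, if_true]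
        ring
      simp_rw [h2]
      rw [integral_const_mul]
      -- The constant `4` is the price of the denominators, which are at least `1/2`.
      have h3 : (1 / (1 - μ.real (B N))) ^ 2 ≤ 4 := by
        have := hden N hN
        have h4 : 1 / (1 - μ.real (B N)) ≤ 2 := by
          rw [div_le_iff₀ (by linarith)]; linarith
        have h5 : 0 ≤ 1 / (1 - μ.real (B N)) := by
          apply div_nonneg <;> linarith
        nlinarith
      exact mul_le_mul h3 h1 (integral_nonneg fun ω => sq_nonneg _) (by norm_num)
  · intro t ht
    have hdt := hden t ht
    have hdN := hden N hN
    -- A point outside `B t` is outside every earlier set of the chain. Moving an observation to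
    -- `e₀` from elsewhere in the complement of `B t` is therefore invisible up to time `t`.
    obtain ⟨e₀, he₀⟩ : ∃ e, e ∉ B t := by
      by_contra hcon
      push Not at hcon
      have : B t = Set.univ := Set.eq_univ_of_forall hcon
      have h := hhalf t ht
      rw [this, probReal_univ] at h
      norm_num at h
    let w : (ℕ → E) → ℝ := fun z => (firstHit S m x t).indicator (fun _ => (1 : ℝ)) z * m t z
    let y : E → ℝ := fun e =>
      ((B N).indicator (fun _ => (1 : ℝ)) e - μ.real (B N)) / (1 - μ.real (B N)) -
      ((B t).indicator (fun _ => (1 : ℝ)) e - μ.real (B t)) / (1 - μ.real (B t))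
    have hind' : ∀ {s : ι}, s ∈ S → Measurable fun e =>
        (B s).indicator (fun _ => (1 : ℝ)) e - μ.real (B s) :=
      fun hs => (measurable_const.indicator (hB _ hs)).sub_const _
    have hmloc : ∀ u z z', (∀ l < n, z l = z' l) → m u z = m u z' := by
      intro u z z' h
      have : centeredCount μ n (B u) z = centeredCount μ n (B u) z' :=
        Finset.sum_congr rfl fun l hl => by rw [h l (Finset.mem_range.1 hl)]
      simp only [m, this]
    have hmupd : ∀ u ∈ S, u ≤ t → ∀ z i, z i ∉ B t → m u (Function.update z i e₀) = m u z := by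
      intro u hu hut z i hz
      have : centeredCount μ n (B u) (Function.update z i e₀) = centeredCount μ n (B u) z := by
        refine Finset.sum_congr rfl fun l _ => ?_
        by_cases hl : l = i
        · subst hl
          have hs := hmono u hu t ht hut
          rw [Function.update_self, Set.indicator_of_notMem fun h => he₀ (hs h),
            Set.indicator_of_notMem fun h => hz (hs h)]
        · rw [Function.update_of_ne hl]
      simp only [m, this]
    have hfh : ∀ z z', (∀ u ∈ S, u ≤ t → m u z = m u z') → w z = w z' := by
      intro z z' h
      have : z ∈ firstHit S m x t ↔ z' ∈ firstHit S m x t := by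
        simp only [firstHit, Set.mem_ofPred_eq, h t ht le_rfl]
        refine and_congr_right fun _ => forall_congr' fun u => ?_
        refine forall_congr' fun hu => forall_congr' fun hut => ?_
        rw [h u hu hut.le]
      simp only [w, h t ht le_rfl]
      by_cases hz : z ∈ firstHit S m x t
      · rw [Set.indicator_of_mem hz, Set.indicator_of_mem (this.1 hz)]
      · rw [Set.indicator_of_notMem hz, Set.indicator_of_notMem fun h => hz (this.2 h)]
    have hmain := integral_mul_sum_eq_zero hZ hind hlaw n (B := B t) (e₀ := e₀) (w := w)
      ((measurable_const.indicator (measurableSet_firstHit S hm x t)).mul (hm t))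
      (C := 2 * n) ?_ ?_ ?_ (y := y) ?_ (K := 4) ?_ ?_ ?_
    · rw [← hmain]
      refine integral_congr_ae (ae_of_all _ fun ω => ?_)
      have : M N ω - M t ω = ∑ i ∈ Finset.range n, y (Z i ω) := by
        simp only [M, m, ht, hN, if_true, y, centeredCount]
        rw [Finset.sum_div, Finset.sum_div, ← Finset.sum_sub_distrib]
      simp only [this]
      rfl
    · intro z
      simp only [w, abs_mul]
      by_cases hz : z ∈ firstHit S m x t
      · simpa [hz] using hmC t z
      · simp [hz]
    · exact fun z z' h => hfh z z' fun u _ _ => hmloc u z z' h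
    · exact fun z i hz => hfh _ _ fun u hu hut => hmupd u hu hut z i hz
    · exact ((hind' hN).div_const _).sub ((hind' ht).div_const _)
    · intro e
      have hb : ∀ s ∈ S, |((B s).indicator (fun _ => (1 : ℝ)) e - μ.real (B s)) /
          (1 - μ.real (B s))| ≤ 2 := by
        intro s hs
        have := hden s hs
        rw [abs_div, abs_of_pos (show (0 : ℝ) < 1 - μ.real (B s) by linarith),
          div_le_iff₀ (by linarith)]
        linarith [abs_indicator_sub_le (μ := μ) (B s) e]
      refine (abs_sub _ _).trans ?_
      linarith [hb N hN, hb t ht]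
    · intro e he
      have heN : e ∈ B N := hmono t ht N hN (S.le_max' t ht) he
      simp only [y, Set.indicator_of_mem he, Set.indicator_of_mem heN]
      rw [div_self (by linarith), div_self (by linarith), sub_self]
    · have hi : ∀ s ∈ S, Integrable (fun e => ((B s).indicator (fun _ => (1 : ℝ)) e -
          μ.real (B s)) / (1 - μ.real (B s))) μ := fun s hs =>
        (((integrable_const _).indicator (hB s hs)).sub (integrable_const _)).div_const _
      simp only [y]
      rw [integral_sub (hi N hN) (hi t ht), integral_div, integral_div,
        integral_indicator_sub (hB N hN), integral_indicator_sub (hB t ht)]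
      simp

end Empirical

/-! ### Scores, quantile grids and the uniform deviation of the empirical distribution. -/

section Regions

variable {d : ℕ} {I : Set ℝ} {D : ℝ → Set (Obs d)}

/-- Off the intersection of all the regions, the score is an element of `I` and encodes membership
in the regions. -/
lemma score_spec (hD : IsRegionFamily I D) (hI : I.OrdConnected) {x : Obs d}
    (hx : x ∉ ⋂ t ∈ I, D t) :
    score I D x ∈ I ∧ ∀ t ∈ I, x ∈ D t ↔ score I D x ≤ t := by
  obtain ⟨u, huI, hu⟩ : ∃ u ∈ I, x ∉ D u := by simpa using hx
  obtain ⟨v, hvI, hv⟩ : ∃ v ∈ I, x ∈ D v := by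
    simpa using (hD.exhaust ▸ Set.mem_univ x : x ∈ ⋃ t ∈ I, D t)
  have hlb : ∀ t ∈ {t | t ∈ I ∧ x ∈ D t}, u ≤ t := fun t ht => by
    by_contra hcon
    exact hu (hD.mono t ht.1 u huI (not_le.1 hcon).le ht.2)
  have hbdd : BddBelow {t | t ∈ I ∧ x ∈ D t} := ⟨u, hlb⟩
  have hne : {t | t ∈ I ∧ x ∈ D t}.Nonempty := ⟨v, hvI, hv⟩
  have hmem : score I D x ∈ I :=
    hI.out huI hvI ⟨le_csInf hne hlb, csInf_le hbdd ⟨hvI, hv⟩⟩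
  have hself : x ∈ D (score I D x) := by
    rw [hD.rightCont _ hmem]
    refine Set.mem_iInter₂.2 fun s hs => ?_
    obtain ⟨t, ht, hts⟩ := exists_lt_of_csInf_lt hne hs.2
    exact hD.mono t ht.1 s hs.1 hts.le ht.2
  exact ⟨hmem, fun t ht => ⟨fun h => csInf_le hbdd ⟨ht, h⟩,
    fun h => hD.mono _ hmem t ht h hself⟩⟩

/-- On the core the score is `sInf I`, possibly the default value of an infimum that is not bounded
below. Its constancy is all that measurability requires there. -/
lemma score_eq_of_mem_core {x y : Obs d} (hx : x ∈ ⋂ t ∈ I, D t) (hy : y ∈ ⋂ t ∈ I, D t) :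
    score I D x = score I D y := by
  rw [Set.mem_iInter₂] at hx hy
  have : {t | t ∈ I ∧ x ∈ D t} = {t | t ∈ I ∧ y ∈ D t} :=
    Set.ext fun t => ⟨fun h => ⟨h.1, hy t h.1⟩, fun h => ⟨h.1, hx t h.1⟩⟩
  simp only [score, this]

lemma exists_rat_mem (hIo : IsOpen I) (hI : I.OrdConnected) {u t : ℝ} (hu : u ∈ I) (hut : u < t) :
    ∃ q : ℚ, (q : ℝ) ∈ I ∧ u < q ∧ (q : ℝ) < t := by
  have h1 : ∀ᶠ v in 𝓝[>] u, v ∈ I := nhdsWithin_le_nhds (hIo.mem_nhds hu)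
  have h2 : ∀ᶠ v in 𝓝[>] u, v < t := nhdsWithin_le_nhds (Iio_mem_nhds hut)
  obtain ⟨v, ⟨hvI, hvt⟩, hv⟩ := ((h1.and h2).and self_mem_nhdsWithin).exists
  obtain ⟨q, hq1, hq2⟩ := exists_rat_btwn (show u < v from hv)
  exact ⟨q, hI.out hu hvI ⟨hq1.le, hq2.le⟩, hq1, hq2.trans hvt⟩

lemma exists_rat_mem' (hIo : IsOpen I) (hI : I.OrdConnected) {u : ℝ} (hu : u ∈ I) :
    ∃ q : ℚ, (q : ℝ) ∈ I ∧ (q : ℝ) < u := by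
  have h1 : ∀ᶠ v in 𝓝[<] u, v ∈ I := nhdsWithin_le_nhds (hIo.mem_nhds hu)
  obtain ⟨v, hvI, hv⟩ := (h1.and self_mem_nhdsWithin).exists
  obtain ⟨q, hq1, hq2⟩ := exists_rat_btwn (show v < u from hv)
  exact ⟨q, hI.out hvI hu ⟨hq1.le, hq2.le⟩, hq2⟩

/-- Rational indices suffice because the open interval `I` has rationals to the left of each of its
points. This gives measurability of the core and continuity of measures along a countable family. -/
lemma core_eq_iInter_rat (hD : IsRegionFamily I D) (hIo : IsOpen I) (hI : I.OrdConnected) :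
    ⋂ t ∈ I, D t = ⋂ q : {q : ℚ // (q : ℝ) ∈ I}, D q := by
  ext x
  simp only [Set.mem_iInter]
  refine ⟨fun h q => h q q.2, fun h t ht => ?_⟩
  obtain ⟨q, hq, hqt⟩ := exists_rat_mem' hIo hI ht
  exact hD.mono q hq t ht hqt.le (h ⟨q, hq⟩)

lemma iUnion_rat_eq_univ (hD : IsRegionFamily I D) (hIo : IsOpen I) (hI : I.OrdConnected) :
    ⋃ q : {q : ℚ // (q : ℝ) ∈ I}, D q = Set.univ := by
  refine Set.eq_univ_of_forall fun x => ?_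
  obtain ⟨t, ht, hx⟩ : ∃ t ∈ I, x ∈ D t := by
    simpa using (hD.exhaust ▸ Set.mem_univ x : x ∈ ⋃ t ∈ I, D t)
  obtain ⟨q, hq, hqt, -⟩ := exists_rat_mem hIo hI ht (lt_add_one t)
  exact Set.mem_iUnion.2 ⟨⟨q, hq⟩, hD.mono t ht q hq hqt.le hx⟩

lemma measurableSet_core (hD : IsRegionFamily I D) (hIo : IsOpen I) (hI : I.OrdConnected) :
    MeasurableSet (⋂ t ∈ I, D t) := by
  rw [core_eq_iInter_rat hD hIo hI]
  exact MeasurableSet.iInter fun q => hD.measurableSet q q.2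

lemma nonempty_rat (hIo : IsOpen I) (hI : I.OrdConnected) (hIne : I.Nonempty) :
    Nonempty {q : ℚ // (q : ℝ) ∈ I} := by
  obtain ⟨t, ht⟩ := hIne
  obtain ⟨q, hq, -⟩ := exists_rat_mem' hIo hI ht
  exact ⟨⟨q, hq⟩⟩

lemma measurable_score (hD : IsRegionFamily I D) (hIo : IsOpen I) (hI : I.OrdConnected) :
    Measurable (score I D) := by
  have hcore := measurableSet_core hD hIo hI
  refine measurable_of_Iio fun t => ?_
  have : score I D ⁻¹' Set.Iio t =
      ((⋂ t ∈ I, D t) ∩ score I D ⁻¹' Set.Iio t) ∪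
        ((⋂ t ∈ I, D t)ᶜ ∩ ⋃ q : ℚ, ⋃ (_ : (q : ℝ) ∈ I ∧ (q : ℝ) < t), D q) := by
    ext x
    by_cases hx : x ∈ ⋂ t ∈ I, D t
    · simp only [Set.mem_union, Set.mem_inter_iff, hx, true_and, Set.mem_compl_iff, not_true,
        false_and, or_false]
    · obtain ⟨h1, h2⟩ := score_spec hD hI hx
      simp only [Set.mem_union, Set.mem_inter_iff, hx, false_and, Set.mem_compl_iff, not_false_iff,
        true_and, false_or, Set.mem_preimage, Set.mem_Iio, Set.mem_iUnion]
      constructor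
      · intro h
        obtain ⟨q, hq, hq1, hq2⟩ := exists_rat_mem hIo hI h1 h
        exact ⟨q, ⟨hq, hq2⟩, (h2 q hq).2 hq1.le⟩
      · rintro ⟨q, ⟨hq, hqt⟩, hxq⟩
        exact ((h2 q hq).1 hxq).trans_lt hqt
  rw [this]
  refine MeasurableSet.union ?_ (hcore.compl.inter ?_)
  · by_cases h : ∃ x ∈ ⋂ t ∈ I, D t, score I D x < t
    · obtain ⟨x, hx, hxt⟩ := h
      rw [Set.inter_eq_left.2]
      · exact hcore
      · intro y hy
        show score I D y < t
        rwa [score_eq_of_mem_core hy hx]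
    · convert MeasurableSet.empty
      ext x
      simp only [Set.mem_inter_iff, Set.mem_empty_iff_false, iff_false]
      exact fun hx => h ⟨x, hx.1, hx.2⟩
  · exact MeasurableSet.iUnion fun q => MeasurableSet.iUnion fun hq => hD.measurableSet q hq.1

lemma monotoneOn_real (hD : IsRegionFamily I D) (μ : Measure (Obs d)) [IsFiniteMeasure μ] :
    MonotoneOn (fun t => μ.real (D t)) I := fun _ hs _ ht hst =>
  measureReal_mono (hD.mono _ hs _ ht hst) (measure_ne_top _ _)

lemma exists_real_lt (hD : IsRegionFamily I D) (hIo : IsOpen I) (hI : I.OrdConnected)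
    (hIne : I.Nonempty) (μ : Measure (Obs d)) [IsFiniteMeasure μ] (hμ : μ (⋂ t ∈ I, D t) = 0)
    {γ : ℝ} (hγ : 0 < γ) : ∃ t ∈ I, μ.real (D t) < γ := by
  have := nonempty_rat hIo hI hIne
  have h := tendsto_measure_iInter_atBot (μ := μ) (s := fun q : {q : ℚ // (q : ℝ) ∈ I} => D q)
    (fun q => (hD.measurableSet q q.2).nullMeasurableSet)
    (fun s t hst => hD.mono s s.2 t t.2 (Rat.cast_le.2 hst))
    ⟨Classical.arbitrary _, measure_ne_top _ _⟩
  rw [← core_eq_iInter_rat hD hIo hI, hμ] at h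
  obtain ⟨t, ht⟩ := (h.eventually (gt_mem_nhds (ENNReal.ofReal_pos.2 hγ))).exists
  exact ⟨t, t.2, (ENNReal.lt_ofReal_iff_toReal_lt (measure_ne_top _ _)).1 ht⟩

lemma exists_lt_real (hD : IsRegionFamily I D) (hIo : IsOpen I) (hI : I.OrdConnected)
    (hIne : I.Nonempty) (μ : Measure (Obs d)) [IsProbabilityMeasure μ] {γ : ℝ} (hγ : γ < 1) :
    ∃ t ∈ I, γ < μ.real (D t) := by
  have := nonempty_rat hIo hI hIne
  have h := tendsto_measure_iUnion_atTop (μ := μ) (s := fun q : {q : ℚ // (q : ℝ) ∈ I} => D q)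
    (fun s t hst => hD.mono s s.2 t t.2 (Rat.cast_le.2 hst))
  rw [iUnion_rat_eq_univ hD hIo hI, measure_univ] at h
  have h' := (ENNReal.tendsto_toReal ENNReal.one_ne_top).comp h
  obtain ⟨t, ht⟩ := (h'.eventually (lt_mem_nhds (show γ < (1 : ENNReal).toReal by simpa))).exists
  exact ⟨t, t.2, ht⟩

lemma exists_real_eq (hD : IsRegionFamily I D) (hIo : IsOpen I) (hI : I.OrdConnected)
    (hIne : I.Nonempty) (μ : Measure (Obs d)) [IsProbabilityMeasure μ] (hμ : μ (⋂ t ∈ I, D t) = 0)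
    (hcont : ContinuousOn (fun t => μ.real (D t)) I) {p : ℝ} (hp : p ∈ Set.Ioo (0 : ℝ) 1) :
    ∃ t ∈ I, μ.real (D t) = p := by
  obtain ⟨s, hs, hs'⟩ := exists_real_lt hD hIo hI hIne μ hμ hp.1
  obtain ⟨t, ht, ht'⟩ := exists_lt_real hD hIo hI hIne μ hp.2
  exact hI.isPreconnected.intermediate_value hs ht hcont ⟨hs'.le, ht'.le⟩

/-- A finite grid of quantiles. -/
lemma exists_grid (hD : IsRegionFamily I D) (hIo : IsOpen I) (hI : I.OrdConnected)
    (hIne : I.Nonempty) (μ : Measure (Obs d)) [IsProbabilityMeasure μ] (hμ : μ (⋂ t ∈ I, D t) = 0)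
    (hcont : ContinuousOn (fun t => μ.real (D t)) I) {γ : ℝ} (hγ : 0 < γ) :
    ∃ S : Finset ℝ, (∀ t ∈ S, t ∈ I) ∧
      (∀ t ∈ I, μ.real (D t) ≤ γ ∨ ∃ u ∈ S, u ≤ t ∧ μ.real (D t) ≤ μ.real (D u) + γ) ∧
      (∀ t ∈ I, 1 - γ ≤ μ.real (D t) ∨ ∃ u ∈ S, t ≤ u ∧ μ.real (D u) ≤ μ.real (D t) + γ) := by
  classical
  obtain ⟨K, hK⟩ := exists_nat_gt (1 / γ)
  have hK0 : (0 : ℝ) < K := lt_trans (by positivity) hK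
  have hKγ : 1 / (K : ℝ) ≤ γ := by
    rw [div_lt_iff₀ hγ] at hK
    rw [div_le_iff₀ hK0]
    linarith
  have hq : ∀ j : ℕ, ∃ t, 0 < j → j < K → t ∈ I ∧ μ.real (D t) = j / K := by
    intro j
    by_cases hj : 0 < j ∧ j < K
    · have hp : (j : ℝ) / K ∈ Set.Ioo (0 : ℝ) 1 := by
        refine ⟨div_pos (by exact_mod_cast hj.1) hK0, ?_⟩
        rw [div_lt_one hK0]
        exact_mod_cast hj.2
      obtain ⟨t, ht, h⟩ := exists_real_eq hD hIo hI hIne μ hμ hcont hp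
      exact ⟨t, fun _ _ => ⟨ht, h⟩⟩
    · exact ⟨0, fun h1 h2 => absurd ⟨h1, h2⟩ hj⟩
  choose g hg using hq
  have hlt : ∀ {s t}, s ∈ I → t ∈ I → μ.real (D s) < μ.real (D t) → s ≤ t := by
    intro s t hs ht h
    by_contra hcon
    exact absurd (monotoneOn_real hD μ ht hs (not_le.1 hcon).le) (not_le.2 h)
  refine ⟨((Finset.range K).filter fun j => 0 < j).image g, ?_, ?_, ?_⟩
  · intro t ht
    obtain ⟨j, hj, rfl⟩ := Finset.mem_image.1 ht
    rw [Finset.mem_filter, Finset.mem_range] at hj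
    exact (hg j hj.2 hj.1).1
  · intro t ht
    set p := μ.real (D t) with hp
    have hp1 : p ≤ 1 := measureReal_le_one
    rcases le_or_gt p γ with h | h
    · exact Or.inl h
    right
    have hpK : 1 < p * K := by
      rw [div_lt_iff₀ hγ] at hK
      nlinarith
    -- The largest `j` with `j / K < p`. The inequality must be strict, since `hlt` orders two
    -- points only when their levels differ.
    obtain ⟨j, hj⟩ : ∃ j : ℕ, ⌈p * K⌉₊ = j + 1 := Nat.exists_eq_succ_of_ne_zero (by
      have : 0 < ⌈p * K⌉₊ := Nat.ceil_pos.2 (by linarith)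
      omega)
    have h1 : (j : ℝ) < p * K := by
      have := Nat.ceil_lt_add_one (show 0 ≤ p * K by linarith)
      rw [hj] at this
      push_cast at this
      linarith
    have h2 : p * K ≤ j + 1 := by
      have := Nat.le_ceil (p * K)
      rw [hj] at this
      exact_mod_cast this
    have hj0 : 0 < j := by
      have : (0 : ℝ) < j := by linarith
      exact_mod_cast this
    have hjK : j < K := by
      have : (j : ℝ) < K := by nlinarith
      exact_mod_cast this
    obtain ⟨hgI, hgq⟩ := hg j hj0 hjK
    refine ⟨g j, Finset.mem_image_of_mem _ (by simp [hj0, hjK]), hlt hgI ht ?_, ?_⟩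
    · rw [hgq, div_lt_iff₀ hK0]
      exact h1
    · rw [hgq]
      have : p ≤ (j + 1) / K := by rwa [le_div_iff₀ hK0]
      rw [add_div] at this
      linarith
  · intro t ht
    set p := μ.real (D t) with hp
    have hp0 : 0 ≤ p := measureReal_nonneg
    rcases le_or_gt (1 - γ) p with h | h
    · exact Or.inl h
    right
    have hpK : p * K + 1 < K := by
      rw [div_lt_iff₀ hγ] at hK
      nlinarith
    have h1 : p * K < (⌊p * K⌋₊ : ℝ) + 1 := Nat.lt_floor_add_one _
    have h2 : (⌊p * K⌋₊ : ℝ) ≤ p * K := Nat.floor_le (by positivity)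
    -- The smallest `j` with `p < j / K`, again strictly.
    set j := ⌊p * K⌋₊ + 1 with hj
    have hjc : (j : ℝ) = ⌊p * K⌋₊ + 1 := by rw [hj]; push_cast; rfl
    have hjK : j < K := by
      have : (j : ℝ) < K := by linarith
      exact_mod_cast this
    have hj0 : 0 < j := Nat.succ_pos _
    obtain ⟨hgI, hgq⟩ := hg j hj0 hjK
    refine ⟨g j, Finset.mem_image_of_mem _ (by simp [hj0, hjK]), hlt ht hgI ?_, ?_⟩
    · rw [hgq, lt_div_iff₀ hK0]
      linarith
    · rw [hgq, hjc, add_div]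
      have : (⌊p * K⌋₊ : ℝ) / K ≤ p := by rwa [div_le_iff₀ hK0]
      linarith

lemma countIn_eq_sum (D : ℝ → Set (Obs d)) (x : ℕ → Obs d) (n : ℕ) (t : ℝ) :
    (countIn D x n t : ℝ) = ∑ i ∈ Finset.range n, (D t).indicator (fun _ => (1 : ℝ)) (x i) := by
  classical
  simp only [countIn, Set.indicator_apply, Finset.sum_ite, Finset.sum_const_zero, add_zero,
    Finset.sum_const, nsmul_eq_mul, mul_one]

lemma centeredCount_eq (μ : Measure (Obs d)) (x : ℕ → Obs d) {n : ℕ} (hn : 0 < n) (t : ℝ) :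
    centeredCount μ n (D t) x = n * (empCdf D x n t - μ.real (D t)) := by
  have : (n : ℝ) ≠ 0 := by positivity
  rw [centeredCount, Finset.sum_sub_distrib, ← countIn_eq_sum, empCdf, mul_sub,
    mul_div_cancel₀ _ this]
  simp

lemma countIn_mono (hD : IsRegionFamily I D) (x : ℕ → Obs d) (n : ℕ) {s t : ℝ} (hs : s ∈ I)
    (ht : t ∈ I) (hst : s ≤ t) : countIn D x n s ≤ countIn D x n t := by
  classical
  exact Finset.card_le_card fun i hi => by
    rw [Finset.mem_filter] at hi ⊢
    exact ⟨hi.1, hD.mono s hs t ht hst hi.2⟩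

lemma countIn_le (x : ℕ → Obs d) (n : ℕ) (t : ℝ) : countIn D x n t ≤ n := by
  classical
  exact (Finset.card_filter_le _ _).trans (by simp)

lemma empCdf_mono (hD : IsRegionFamily I D) (x : ℕ → Obs d) (n : ℕ) {s t : ℝ} (hs : s ∈ I)
    (ht : t ∈ I) (hst : s ≤ t) : empCdf D x n s ≤ empCdf D x n t := by
  unfold empCdf
  gcongr
  exact countIn_mono hD x n hs ht hst

lemma empCdf_nonneg (x : ℕ → Obs d) (n : ℕ) (t : ℝ) : 0 ≤ empCdf D x n t := by
  unfold empCdf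
  positivity

lemma empCdf_le_one (x : ℕ → Obs d) (n : ℕ) (t : ℝ) : empCdf D x n t ≤ 1 :=
  div_le_one_of_le₀ (by exact_mod_cast countIn_le x n t) (by positivity)

/-- The uniform deviation of the empirical distribution is of order `n ^ (-1/2)`. -/
lemma measure_deviation_le {Ω : Type*} [MeasurableSpace Ω] {P : Measure Ω} [IsProbabilityMeasure P]
    (hD : IsRegionFamily I D) (hIo : IsOpen I) (hI : I.OrdConnected) (hIne : I.Nonempty)
    {μ : Measure (Obs d)} [IsProbabilityMeasure μ] (hμ : μ (⋂ t ∈ I, D t) = 0)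
    (hcont : ContinuousOn (fun t => μ.real (D t)) I) {X : ℕ → Ω → Obs d}
    (hX : ∀ i, Measurable (X i)) (hind : iIndepFun X P) (hlaw : ∀ i, P.map (X i) = μ)
    {n : ℕ} (hn : 0 < n) {γ : ℝ} (hγ : 0 < γ) :
    P.real {ω | ∃ t ∈ I, 2 * γ < |empCdf D (fun i => X i ω) n t - μ.real (D t)|} ≤
      8 / (n * γ ^ 2) := by
  classical
  have hn' : (0 : ℝ) < n := by exact_mod_cast hn
  obtain ⟨S, hSI, hS1, hS2⟩ := exists_grid hD hIo hI hIne μ hμ hcont hγ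
  -- The maximal inequality needs measures at most `1/2`, so the grid is cut at the median. Above it
  -- the complements are used; they increase along the reversed order, hence `ℝᵒᵈ`. Each half
  -- contributes `4 / (n * γ ^ 2)` to the final bound.
  let S₁ : Finset ℝ := S.filter fun t => μ.real (D t) ≤ 1 / 2
  let S₂ : Finset ℝᵒᵈ := (S.filter fun t => 1 / 2 ≤ μ.real (D t)).map OrderDual.toDual.toEmbedding
  have hS₂ : ∀ t, t ∈ S₂ ↔ OrderDual.ofDual t ∈ S ∧ 1 / 2 ≤ μ.real (D (OrderDual.ofDual t)) := by
    intro t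
    simp only [S₂, Finset.mem_map_equiv, Finset.mem_filter]
    rfl
  have hcompl : ∀ t ∈ I, μ.real (D t)ᶜ = 1 - μ.real (D t) := fun t ht =>
    probReal_compl_eq_one_sub (hD.measurableSet t ht)
  have h1 := maximal_centeredCount hX hind hlaw n (S := S₁) (B := D)
    (fun t ht => hD.measurableSet t (hSI t (Finset.mem_filter.1 ht).1))
    (fun t ht u hu htu => hD.mono t (hSI t (Finset.mem_filter.1 ht).1) u
      (hSI u (Finset.mem_filter.1 hu).1) htu)
    (fun t ht => (Finset.mem_filter.1 ht).2) (x := n * γ) (by positivity)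
  have h2 := maximal_centeredCount hX hind hlaw n (S := S₂)
    (B := fun t => (D (OrderDual.ofDual t))ᶜ)
    (fun t ht => (hD.measurableSet _ (hSI _ ((hS₂ t).1 ht).1)).compl)
    (fun t ht u hu htu => Set.compl_subset_compl.2 (hD.mono _ (hSI _ ((hS₂ u).1 hu).1) _
      (hSI _ ((hS₂ t).1 ht).1) htu))
    (fun t ht => by
      rw [hcompl _ (hSI _ ((hS₂ t).1 ht).1)]
      linarith [((hS₂ t).1 ht).2]) (x := n * γ) (by positivity)
  set A₁ := {ω | ∃ t ∈ S₁, n * γ ≤ |centeredCount μ n (D t) (fun i => X i ω)|}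
  set A₂ := {ω | ∃ t ∈ S₂, n * γ ≤
    |centeredCount μ n (D (OrderDual.ofDual t))ᶜ (fun i => X i ω)|}
  have hsub : {ω | ∃ t ∈ I, 2 * γ < |empCdf D (fun i => X i ω) n t - μ.real (D t)|} ⊆
      A₁ ∪ A₂ := by
    rintro ω ⟨t, ht, hdev⟩
    by_contra hcon
    have hcc : ∀ u ∈ S, |empCdf D (fun i => X i ω) n u - μ.real (D u)| < γ := by
      intro u hu
      have key : |centeredCount μ n (D u) (fun i => X i ω)| < n * γ := by
        by_contra hc
        rw [not_lt] at hc
        rcases le_total (μ.real (D u)) (1 / 2) with h | h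
        · exact hcon (Or.inl ⟨u, Finset.mem_filter.2 ⟨hu, h⟩, hc⟩)
        · refine hcon (Or.inr ⟨OrderDual.toDual u, (hS₂ _).2 ⟨hu, h⟩, hc.trans_eq ?_⟩)
          have : centeredCount μ n (D u)ᶜ (fun i => X i ω) =
              -centeredCount μ n (D u) (fun i => X i ω) := by
            rw [centeredCount, centeredCount, ← Finset.sum_neg_distrib]
            refine Finset.sum_congr rfl fun i _ => ?_
            rw [hcompl u (hSI u hu)]
            by_cases hm : X i ω ∈ D u <;> simp [hm]
          rw [← abs_neg, ← this]
          rfl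
      rw [centeredCount_eq μ _ hn, abs_mul, abs_of_pos hn'] at key
      exact lt_of_mul_lt_mul_left key hn'.le
    -- One `γ` is the deviation at a grid point and the other the mesh of the grid. In the two
    -- tails, where there may be no grid point, the trivial bounds `0` and `1` suffice.
    have hup : empCdf D (fun i => X i ω) n t - μ.real (D t) ≤ 2 * γ := by
      rcases hS2 t ht with h | ⟨u, hu, htu, h⟩
      · linarith [empCdf_le_one (D := D) (fun i => X i ω) n t]
      · linarith [empCdf_mono hD (fun i => X i ω) n ht (hSI u hu) htu, (abs_lt.1 (hcc u hu)).2]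
    have hdn : -(2 * γ) ≤ empCdf D (fun i => X i ω) n t - μ.real (D t) := by
      rcases hS1 t ht with h | ⟨u, hu, htu, h⟩
      · linarith [empCdf_nonneg (D := D) (fun i => X i ω) n t]
      · linarith [empCdf_mono hD (fun i => X i ω) n (hSI u hu) ht htu, (abs_lt.1 (hcc u hu)).1]
    exact absurd (abs_le.2 ⟨hdn, hup⟩) (not_le.2 hdev)
  have hP : P.real (A₁ ∪ A₂) ≤ P.real A₁ + P.real A₂ := measureReal_union_le _ _
  have hle := (measureReal_mono (μ := P) hsub (measure_ne_top _ _)).trans hP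
  refine hle.trans ?_
  have e : ∀ p : ℝ, (n * γ) ^ 2 * p ≤ 4 * n → p ≤ 4 / (n * γ ^ 2) := by
    intro p hp
    rw [le_div_iff₀ (by positivity)]
    refine le_of_mul_le_mul_left ?_ hn'
    linarith
  have := add_le_add (e _ h1) (e _ h2)
  refine this.trans_eq ?_
  ring

end Regions

/-! ### The mixture law and its marginals. -/

section Mixture

variable {Ω : Type*} [MeasurableSpace Ω] {P : Measure Ω} {d L : ℕ}
  {F : Fin L → Measure (Obs d)} [∀ k, IsProbabilityMeasure (F k)]
  {G : Measure (Obs d)} [IsProbabilityMeasure G] {ν : Fin L → ℝ} {a : ℝ}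

lemma mixtureLaw_prod {U : Set (Fin L ⊕ Unit)} {B : Set (Obs d)} :
    mixtureLaw F G ν a (U ×ˢ B) =
      ENNReal.ofReal a * (U.indicator 1 (Sum.inr ()) * G B) +
        ∑ k, ENNReal.ofReal ((1 - a) * ν k) * (U.indicator 1 (Sum.inl k) * F k B) := by
  have hU : MeasurableSet U := measurableSet_sum_iff.2 ⟨.of_discrete, .of_discrete⟩
  simp [mixtureLaw, Measure.prod_prod, Measure.dirac_apply' _ hU]

lemma mixtureLaw_univ_prod (hν : ∀ k, 0 ≤ ν k) (ha : a ∈ Set.Ioo (0 : ℝ) 1) (B : Set (Obs d)) :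
    (mixtureLaw F G ν a).real (Set.univ ×ˢ B) =
      (1 - a) * ∑ k, ν k * (F k).real B + a * G.real B := by
  have h1a : 0 ≤ 1 - a := by linarith [ha.2]
  rw [Measure.real, mixtureLaw_prod, ENNReal.toReal_add, ENNReal.toReal_sum]
  · simp [ENNReal.toReal_mul, ENNReal.toReal_ofReal, ha.1.le, mul_nonneg h1a (hν _), Measure.real,
      Finset.mul_sum, mul_assoc, add_comm]
  · intro k _
    simp [ENNReal.mul_eq_top]
  · simp [ENNReal.mul_eq_top]
  · simp [ENNReal.mul_eq_top, ENNReal.sum_eq_top]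

lemma mixtureLaw_isLeft_prod (hν : ∀ k, 0 ≤ ν k) (ha : a ∈ Set.Ioo (0 : ℝ) 1) (B : Set (Obs d)) :
    (mixtureLaw F G ν a).real ({l | l.isLeft} ×ˢ B) = (1 - a) * ∑ k, ν k * (F k).real B := by
  have h1a : 0 ≤ 1 - a := by linarith [ha.2]
  rw [Measure.real, mixtureLaw_prod, ENNReal.toReal_add, ENNReal.toReal_sum]
  · simp [ENNReal.toReal_mul, ENNReal.toReal_ofReal, mul_nonneg h1a (hν _), Measure.real,
      Finset.mul_sum, mul_assoc, Set.indicator_apply]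
  · intro k _
    simp [ENNReal.mul_eq_top, Set.indicator_apply]
  · simp
  · simp [ENNReal.mul_eq_top, ENNReal.sum_eq_top, Set.indicator_apply]

variable {η : ℕ → Ω → Fin L ⊕ Unit} {X : ℕ → Ω → Obs d}

omit [∀ k, IsProbabilityMeasure (F k)] [IsProbabilityMeasure G] in
lemma IsMixtureSample.measurable_pair (hX : IsMixtureSample P F G ν a η X) (i : ℕ) :
    Measurable fun ω => (η i ω, X i ω) := (hX.measurable_id i).prodMk (hX.measurable_obs i)

/-- The law of a single observation. -/
noncomputable def obsLaw (F : Fin L → Measure (Obs d)) (G : Measure (Obs d)) (ν : Fin L → ℝ)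
    (a : ℝ) : Measure (Obs d) := (mixtureLaw F G ν a).map Prod.snd

lemma obsLaw_real (hν : ∀ k, 0 ≤ ν k) (ha : a ∈ Set.Ioo (0 : ℝ) 1) {B : Set (Obs d)}
    (hB : MeasurableSet B) :
    (obsLaw F G ν a).real B = (1 - a) * ∑ k, ν k * (F k).real B + a * G.real B := by
  rw [obsLaw, map_measureReal_apply measurable_snd hB, ← mixtureLaw_univ_prod hν ha, Set.univ_prod]

lemma isProbabilityMeasure_mixtureLaw (hν : ∀ k, 0 ≤ ν k) (hνsum : ∑ k, ν k = 1)
    (ha : a ∈ Set.Ioo (0 : ℝ) 1) : IsProbabilityMeasure (mixtureLaw F G ν a) := by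
  have h := mixtureLaw_univ_prod (F := F) (G := G) hν ha Set.univ
  simp only [Set.univ_prod_univ, probReal_univ, mul_one, hνsum] at h
  refine ⟨(ENNReal.toReal_eq_one_iff _).1 ?_⟩
  exact h.trans (by ring)

omit [∀ k, IsProbabilityMeasure (F k)] [IsProbabilityMeasure G] in
lemma IsMixtureSample.map_obs (hX : IsMixtureSample P F G ν a η X) (i : ℕ) :
    P.map (X i) = obsLaw F G ν a := by
  rw [obsLaw, ← hX.law i, Measure.map_map measurable_snd (hX.measurable_pair i)]
  rfl

omit [∀ k, IsProbabilityMeasure (F k)] [IsProbabilityMeasure G] in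
lemma IsMixtureSample.indep_obs (hX : IsMixtureSample P F G ν a η X) : iIndepFun X P :=
  hX.indep.comp (fun _ => Prod.snd) fun _ => measurable_snd

lemma obsLaw_eq_zero {B : Set (Obs d)} (hB : MeasurableSet B) (hF : ∀ k, F k B = 0)
    (hG : G B = 0) : obsLaw F G ν a B = 0 := by
  rw [obsLaw, Measure.map_apply measurable_snd hB, ← Set.univ_prod, mixtureLaw_prod]
  simp [hF, hG]

end Mixture

/-- The regularity hypotheses on the model. -/
structure IsRegularModel {d L : ℕ} (I : Set ℝ) (D : ℝ → Set (Obs d)) (F : Fin L → Measure (Obs d))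
    (G : Measure (Obs d)) (ν : Fin L → ℝ) (a : ℝ) : Prop where
  isOpen : IsOpen I
  ordConnected : I.OrdConnected
  nonempty : I.Nonempty
  family : IsRegionFamily I D
  core_null : ∀ k, F k (⋂ t ∈ I, D t) = 0
  core_alt : G (⋂ t ∈ I, D t) = 0
  prior_nonneg : ∀ k, 0 ≤ ν k
  prior_sum : ∑ k, ν k = 1
  frac_mem : a ∈ Set.Ioo (0 : ℝ) 1
  continuous_level : ∀ k, Continuous (level I D (F k))
  continuousOn_alt : ContinuousOn (fun t => G.real (D t)) I

/-! ### Algebra and bounds for the combinations `cᵀφ`. -/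

section Combinations

variable {d L : ℕ} {I : Set ℝ} {D : ℝ → Set (Obs d)} {F : Fin L → Measure (Obs d)}

lemma level_of_mem (P : Measure (Obs d)) {t : ℝ} (ht : t ∈ I) : level I D P t = P.real (D t) := by
  simp [level, ht]

lemma comb_of_mem (c : Fin L → ℝ) {t : ℝ} (ht : t ∈ I) :
    comb I D F c t = ∑ k, c k * (F k).real (D t) := by
  simp [comb, level_of_mem _ ht]

lemma comb_smul (θ : ℝ) (c : Fin L → ℝ) (t : ℝ) :
    comb I D F (fun k => θ * c k) t = θ * comb I D F c t := by
  simp [comb, Finset.mul_sum, mul_assoc]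

lemma comb_mix (θ : ℝ) (c c' : Fin L → ℝ) (t : ℝ) :
    comb I D F (fun k => (1 - θ) * c k + θ * c' k) t =
      (1 - θ) * comb I D F c t + θ * comb I D F c' t := by
  simp only [comb, Finset.mul_sum, ← Finset.sum_add_distrib]
  exact Finset.sum_congr rfl fun k _ => by ring

@[simp] lemma comb_zero (t : ℝ) : comb I D F 0 t = 0 := by simp [comb]

lemma zero_mem_Delta : (0 : Fin L → ℝ) ∈ Delta L := by simp [Delta]

lemma mem_Delta_of_sum {c : Fin L → ℝ} (h0 : ∀ k, 0 ≤ c k) (h1 : ∑ k, c k ≤ 1) : c ∈ Delta L :=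
  ⟨fun k => ⟨h0 k, (Finset.single_le_sum (fun j _ => h0 j) (Finset.mem_univ k)).trans h1⟩, h1⟩

lemma mix_mem_Delta {c c' : Fin L → ℝ} (hc : c ∈ Delta L) (hc' : c' ∈ Delta L) {θ : ℝ}
    (hθ : θ ∈ Set.Icc (0 : ℝ) 1) : (fun k => (1 - θ) * c k + θ * c' k) ∈ Delta L := by
  have h1 : 0 ≤ 1 - θ := by linarith [hθ.2]
  refine mem_Delta_of_sum (fun k => add_nonneg (mul_nonneg h1 (hc.1 k).1)
    (mul_nonneg hθ.1 (hc'.1 k).1)) ?_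
  rw [Finset.sum_add_distrib, ← Finset.mul_sum, ← Finset.mul_sum]
  have := mul_le_mul_of_nonneg_left hc.2 h1
  have := mul_le_mul_of_nonneg_left hc'.2 hθ.1
  linarith

lemma isCompact_Delta : IsCompact (Delta L) := by
  have : Delta L = (Set.univ.pi fun _ => Set.Icc (0 : ℝ) 1) ∩ {c | ∑ k, c k ≤ 1} := by
    ext c
    simp only [Delta, Set.mem_inter_iff, Set.mem_univ_pi]
    rfl
  rw [this]
  refine (isCompact_univ_pi fun _ => isCompact_Icc).inter_right ?_
  exact isClosed_le (by fun_prop) continuous_const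

lemma continuous_comb_coeff (t : ℝ) : Continuous fun c : Fin L → ℝ => comb I D F c t := by
  unfold comb
  fun_prop

variable [∀ k, IsProbabilityMeasure (F k)]

lemma comb_monotoneOn (hD : IsRegionFamily I D) {c : Fin L → ℝ} (hc : ∀ k, 0 ≤ c k) :
    MonotoneOn (comb I D F c) I := by
  intro s hs t ht hst
  rw [comb_of_mem c hs, comb_of_mem c ht]
  exact Finset.sum_le_sum fun k _ =>
    mul_le_mul_of_nonneg_left (monotoneOn_real hD (F k) hs ht hst) (hc k)

omit [∀ k, IsProbabilityMeasure (F k)] in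
lemma comb_nonneg {c : Fin L → ℝ} (hc : c ∈ Delta L) {t : ℝ} (ht : t ∈ I) :
    0 ≤ comb I D F c t := by
  rw [comb_of_mem c ht]
  exact Finset.sum_nonneg fun k _ => mul_nonneg (hc.1 k).1 measureReal_nonneg

lemma comb_le_one {c : Fin L → ℝ} (hc : c ∈ Delta L) {t : ℝ} (ht : t ∈ I) :
    comb I D F c t ≤ 1 := by
  rw [comb_of_mem c ht]
  refine le_trans (Finset.sum_le_sum fun k _ => ?_) hc.2
  exact mul_le_of_le_one_right (hc.1 k).1 measureReal_le_one

/-- The Lipschitz bound is uniform in `t`, so closeness of coefficients becomes uniform closeness of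
the functions on `I`. -/
lemma comb_le_add (c c' : Fin L → ℝ) {t : ℝ} (ht : t ∈ I) :
    comb I D F c t ≤ comb I D F c' t + ∑ k, |c k - c' k| := by
  rw [comb_of_mem c ht, comb_of_mem c' ht, ← Finset.sum_add_distrib]
  refine Finset.sum_le_sum fun k _ => ?_
  have h0 : 0 ≤ (F k).real (D t) := measureReal_nonneg
  have h1 : (F k).real (D t) ≤ 1 := measureReal_le_one
  nlinarith [le_abs_self (c k - c' k), abs_nonneg (c k - c' k)]

variable {e : ℝ} {T : Finset ℝ} {x : ℕ → Obs d} {n : ℕ}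

lemma comb_le_dataMax {c : Fin L → ℝ} (hc : c ∈ Delta L)
    (hmem : comb I D F c ∈ dataFamily I D e T x n) {t : ℝ} (ht : t ∈ I) :
    comb I D F c t ≤ dataMax I D F e T x n t := by
  refine le_csSup ⟨1, ?_⟩ ⟨c, hc, hmem, rfl⟩
  rintro y ⟨c', hc', -, rfl⟩
  exact comb_le_one hc' ht

omit [∀ k, IsProbabilityMeasure (F k)] in
lemma dataMax_le {t b : ℝ} (hb : 0 ≤ b)
    (h : ∀ c ∈ Delta L, comb I D F c ∈ dataFamily I D e T x n → comb I D F c t ≤ b) :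
    dataMax I D F e T x n t ≤ b := by
  refine Real.sSup_le ?_ hb
  rintro y ⟨c, hc, hmem, rfl⟩
  exact h c hc hmem

end Combinations

/-! ### The limit family and the approximation of feasible coefficients by it. -/

section Limit

variable {d L : ℕ} {I : Set ℝ} {D : ℝ → Set (Obs d)} {F : Fin L → Measure (Obs d)}
  [∀ k, IsProbabilityMeasure (F k)] {G : Measure (Obs d)} [IsProbabilityMeasure G]
  {ν : Fin L → ℝ} {a : ℝ}

namespace IsRegularModel

variable (hM : IsRegularModel I D F G ν a)
include hM

omit [∀ k, IsProbabilityMeasure (F k)] [IsProbabilityMeasure G] in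
lemma continuous_comb (c : Fin L → ℝ) : Continuous (comb I D F c) :=
  continuous_finsetSum _ fun k _ => (hM.continuous_level k).const_mul _

lemma popCdf_eq {t : ℝ} (ht : t ∈ I) :
    popCdf I D F G ν a t = (obsLaw F G ν a).real (D t) := by
  rw [obsLaw_real hM.prior_nonneg hM.frac_mem (hM.family.measurableSet t ht), popCdf,
    comb_of_mem _ ht, level_of_mem _ ht]

lemma isProbabilityMeasure_obsLaw : IsProbabilityMeasure (obsLaw F G ν a) := by
  have := isProbabilityMeasure_mixtureLaw (F := F) (G := G) hM.prior_nonneg hM.prior_sum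
    hM.frac_mem
  exact Measure.isProbabilityMeasure_map measurable_snd.aemeasurable

lemma obsLaw_core : obsLaw F G ν a (⋂ t ∈ I, D t) = 0 :=
  obsLaw_eq_zero (measurableSet_core hM.family hM.isOpen hM.ordConnected) hM.core_null hM.core_alt

omit [∀ k, IsProbabilityMeasure (F k)] [IsProbabilityMeasure G] in
lemma continuousOn_popCdf : ContinuousOn (popCdf I D F G ν a) I := by
  refine ((hM.continuous_comb ν).continuousOn.const_mul _).add (ContinuousOn.const_mul ?_ _)
  exact hM.continuousOn_alt.congr fun t ht => level_of_mem _ ht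

omit [∀ k, IsProbabilityMeasure (F k)] [IsProbabilityMeasure G] in
lemma continuousAt_popCdf {t : ℝ} (ht : t ∈ I) : ContinuousAt (popCdf I D F G ν a) t :=
  hM.continuousOn_popCdf.continuousAt (hM.isOpen.mem_nhds ht)

lemma monotoneOn_popCdf : MonotoneOn (popCdf I D F G ν a) I := by
  have := hM.isProbabilityMeasure_obsLaw
  intro s hs t ht hst
  rw [hM.popCdf_eq hs, hM.popCdf_eq ht]
  exact monotoneOn_real hM.family _ hs ht hst

lemma popCdf_nonneg {t : ℝ} (ht : t ∈ I) : 0 ≤ popCdf I D F G ν a t := by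
  rw [hM.popCdf_eq ht]
  exact measureReal_nonneg

omit [∀ k, IsProbabilityMeasure (F k)] [IsProbabilityMeasure G] in
lemma prior_mem : ν ∈ Delta L := mem_Delta_of_sum hM.prior_nonneg hM.prior_sum.le

-- The core is null for every `F k`, so all the levels vanish towards the left end of `I`. The order
-- dual in the proof turns a finite upper bound into a point to the left of all the chosen ones.
omit [IsProbabilityMeasure G] in
lemma exists_comb_lt {c : Fin L → ℝ} (hc : c ∈ Delta L) {t₀ : ℝ} (ht₀ : t₀ ∈ I) {γ : ℝ}
    (hγ : 0 < γ) : ∃ t ∈ I, t ≤ t₀ ∧ comb I D F c t < γ := by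
  classical
  have h1 : ∀ k, ∃ t : I, (F k).real (D t) < γ / 2 := fun k => by
    obtain ⟨t, ht, h⟩ := exists_real_lt hM.family hM.isOpen hM.ordConnected hM.nonempty (F k)
      (hM.core_null k) (half_pos hγ)
    exact ⟨⟨t, ht⟩, h⟩
  choose s hs using h1
  have : Nonempty I := hM.nonempty.to_subtype
  obtain ⟨t, ht⟩ : ∃ t : I, ∀ u ∈ insert (⟨t₀, ht₀⟩ : I) (Finset.univ.image s), t ≤ u :=
    Finset.exists_le (α := Iᵒᵈ) _
  refine ⟨t, t.2, ht ⟨t₀, ht₀⟩ (Finset.mem_insert_self _ _), ?_⟩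
  rw [comb_of_mem c t.2]
  calc ∑ k, c k * (F k).real (D t) ≤ ∑ k, c k * (γ / 2) := by
        refine Finset.sum_le_sum fun k _ => mul_le_mul_of_nonneg_left ?_ (hc.1 k).1
        have hts : t ≤ s k :=
          ht _ (Finset.mem_insert_of_mem (Finset.mem_image_of_mem _ (Finset.mem_univ k)))
        exact (monotoneOn_real hM.family (F k) t.2 (s k).2 hts).trans (hs k).le
    _ ≤ 1 * (γ / 2) := by
        rw [← Finset.sum_mul]
        exact mul_le_mul_of_nonneg_right hc.2 (by linarith)
    _ < γ := by linarith

-- Every level tends to `1` at the right end of `I`, and `ν` has total mass exactly one. This makes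
-- `ν` the direction in which a smaller combination can be raised there.
omit [IsProbabilityMeasure G] in
lemma exists_lt_comb_prior {γ : ℝ} (hγ : γ < 1) :
    ∃ b ∈ I, ∀ t ∈ I, b ≤ t → γ < comb I D F ν t := by
  classical
  have h1 : ∀ k, ∃ t : I, (γ + 1) / 2 < (F k).real (D t) := fun k => by
    obtain ⟨t, ht, h⟩ := exists_lt_real hM.family hM.isOpen hM.ordConnected hM.nonempty (F k)
      (γ := (γ + 1) / 2) (by linarith)
    exact ⟨⟨t, ht⟩, h⟩
  choose s hs using h1
  have : Nonempty I := hM.nonempty.to_subtype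
  obtain ⟨b, hb⟩ := (Finset.univ.image s).exists_le
  refine ⟨b, b.2, fun t ht hbt => ?_⟩
  rw [comb_of_mem ν ht]
  calc γ < 1 * ((γ + 1) / 2) := by linarith
    _ = ∑ k, ν k * ((γ + 1) / 2) := by rw [← Finset.sum_mul, hM.prior_sum]
    _ ≤ ∑ k, ν k * (F k).real (D t) := by
        refine Finset.sum_le_sum fun k _ => mul_le_mul_of_nonneg_left ?_ (hM.prior_nonneg k)
        have hsb : s k ≤ b := hb _ (Finset.mem_image_of_mem _ (Finset.mem_univ k))
        exact (hs k).le.trans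
          (monotoneOn_real hM.family (F k) (s k).2 ht (le_trans (show (s k : ℝ) ≤ b from hsb) hbt))

/-- Non-negativity is automatic in the definition of the limit family. -/
lemma comb_mem_limitFamily {c : Fin L → ℝ} (hc : c ∈ Delta L)
    (h : MonotoneOn (fun t => popCdf I D F G ν a t - comb I D F c t) I) :
    comb I D F c ∈ limitFamily I (popCdf I D F G ν a) := by
  refine ⟨(hM.continuous_comb c).continuousOn, fun t ht => ?_, h⟩
  refine le_of_forall_pos_le_add fun γ hγ => ?_
  obtain ⟨u, hu, hut, hlt⟩ := hM.exists_comb_lt hc ht hγ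
  have := h hu ht hut
  have := hM.popCdf_nonneg hu
  dsimp only at *
  linarith

/-- The true nulls' part of the mixture belongs to the limit family. -/
lemma comb_true_mem :
    (fun k => (1 - a) * ν k) ∈ Delta L ∧
      comb I D F (fun k => (1 - a) * ν k) ∈ limitFamily I (popCdf I D F G ν a) := by
  have h1a : 0 ≤ 1 - a := by linarith [hM.frac_mem.2]
  have hmem : (fun k => (1 - a) * ν k) ∈ Delta L := by
    refine mem_Delta_of_sum (fun k => mul_nonneg h1a (hM.prior_nonneg k)) ?_
    rw [← Finset.mul_sum, hM.prior_sum]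
    linarith [hM.frac_mem.1]
  refine ⟨hmem, hM.comb_mem_limitFamily hmem fun s hs t ht hst => ?_⟩
  simp only [comb_smul, popCdf, level_of_mem G hs, level_of_mem G ht, add_sub_cancel_left]
  exact mul_le_mul_of_nonneg_left (monotoneOn_real hM.family G hs ht hst) hM.frac_mem.1.le

lemma zero_mem : comb I D F 0 ∈ limitFamily I (popCdf I D F G ν a) :=
  hM.comb_mem_limitFamily zero_mem_Delta (by simpa using hM.monotoneOn_popCdf)

omit hM in
omit [IsProbabilityMeasure G] in
lemma _root_.CompositeNull.comb_le_limitMax {c : Fin L → ℝ} (hc : c ∈ Delta L)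
    (hmem : comb I D F c ∈ limitFamily I (popCdf I D F G ν a)) {t : ℝ} (ht : t ∈ I) :
    comb I D F c t ≤ limitMax I D F G ν a t := by
  refine le_csSup ⟨1, ?_⟩ ⟨c, hc, hmem, rfl⟩
  rintro y ⟨c', hc', -, rfl⟩
  exact comb_le_one hc' ht

lemma exists_comb_of_lt_limitMax {t y : ℝ} (h : y < limitMax I D F G ν a t) :
    ∃ c ∈ Delta L, comb I D F c ∈ limitFamily I (popCdf I D F G ν a) ∧ y < comb I D F c t := by
  obtain ⟨_, ⟨c, hc, hmem, rfl⟩, hlt⟩ := exists_lt_of_lt_csSup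
    (s := {y | ∃ c ∈ Delta L, comb I D F c ∈ limitFamily I (popCdf I D F G ν a) ∧
      y = comb I D F c t}) ⟨_, 0, zero_mem_Delta, hM.zero_mem, rfl⟩ h
  exact ⟨c, hc, hmem, hlt⟩

lemma limitMax_nonneg {t : ℝ} (ht : t ∈ I) : 0 ≤ limitMax I D F G ν a t := by
  simpa using comb_le_limitMax zero_mem_Delta hM.zero_mem ht

end IsRegularModel

/-- Points of increasingly dense grids converging to a given point. -/
lemma IncreasinglyDense.exists_tendsto {T : ℕ → Finset ℝ} {I : Set ℝ} (hT : IncreasinglyDense T I)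
    {t : ℝ} (ht : t ∈ I) : ∃ u : ℕ → ℝ, (∀ᶠ n in atTop, u n ∈ T n) ∧ Tendsto u atTop (𝓝 t) := by
  classical
  have h := hT (|t| + 1) (by positivity)
  have hle : ∀ n, Metric.infEDist t (T n) ≤
      excess (T n : Set ℝ) (I ∩ Set.Icc (-(|t| + 1)) (|t| + 1)) :=
    fun n => le_iSup₂_of_le t ⟨ht, by
      have := abs_le.1 (le_refl |t|)
      constructor <;> linarith [this.1, this.2]⟩ le_rfl
  have h0 : Tendsto (fun n => Metric.infEDist t (T n : Set ℝ)) atTop (𝓝 0) :=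
    tendsto_of_tendsto_of_tendsto_of_le_of_le tendsto_const_nhds h (fun _ => zero_le) hle
  have hex : ∀ n, ∃ u, (T n).Nonempty → u ∈ T n ∧ edist t u = Metric.infEDist t (T n : Set ℝ) := by
    intro n
    by_cases hne : (T n).Nonempty
    · obtain ⟨u, hu, he⟩ := (T n).finite_toSet.isCompact.exists_infEDist_eq_edist
        (Finset.coe_nonempty.2 hne) t
      exact ⟨u, fun _ => ⟨hu, he.symm⟩⟩
    · exact ⟨0, fun h => absurd h hne⟩
  choose u hu using hex
  have hne : ∀ᶠ n in atTop, (T n).Nonempty := by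
    filter_upwards [h0.eventually (gt_mem_nhds ENNReal.zero_lt_top)] with n hn
    by_contra hcon
    rw [Finset.not_nonempty_iff_eq_empty] at hcon
    simp [hcon] at hn
  refine ⟨u, hne.mono fun n hn => (hu n hn).1, ?_⟩
  rw [tendsto_iff_edist_tendsto_0]
  refine h0.congr' (hne.mono fun n hn => ?_)
  show _ = edist (u n) t
  rw [edist_comm, (hu n hn).2]

namespace IsRegularModel

variable (hM : IsRegularModel I D F G ν a)
include hM

/-- Coefficients that nearly satisfy the increment constraints on the grids are eventually close
to the limit set. -/
lemma eventually_close {T : ℕ → Finset ℝ} (hT : IncreasinglyDense T I) {ε : ℕ → ℝ}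
    (hε : Tendsto ε atTop (𝓝 0)) {δ : ℝ} (hδ : 0 < δ) :
    ∀ᶠ n in atTop, ∀ c ∈ Delta L, (∀ s ∈ T n, ∀ t ∈ T n, s < t →
      comb I D F c t - comb I D F c s ≤
        popCdf I D F G ν a t - popCdf I D F G ν a s + 2 * ε n) →
      ∃ c' ∈ Delta L, comb I D F c' ∈ limitFamily I (popCdf I D F G ν a) ∧
        ∑ k, |c k - c' k| < δ := by
  set C := {c ∈ Delta L | comb I D F c ∈ limitFamily I (popCdf I D F G ν a)} with hC
  -- Outside the open neighbourhood `U` of the limit set, each `c` violates monotonicity strictly at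
  -- some pair `s < t`. By continuity the violation survives for nearby coefficients at nearby grid
  -- points with a small error `ε n`. Compactness of `Delta L \ U` makes the threshold on `n`
  -- uniform.
  let U : Set (Fin L → ℝ) := ⋃ c' ∈ C, {c | ∑ k, |c k - c' k| < δ}
  have hU : IsOpen U := isOpen_biUnion fun c' _ => isOpen_lt (by fun_prop) continuous_const
  have hCU : C ⊆ U := fun c hc => Set.mem_biUnion hc (by simpa using hδ)
  have hK : IsCompact (Delta L \ U) := isCompact_Delta.diff hU
  have hloc : ∀ c ∈ Delta L \ U, ∀ᶠ z : ℕ × (Fin L → ℝ) in atTop ×ˢ 𝓝 c,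
      ¬ ∀ s ∈ T z.1, ∀ t ∈ T z.1, s < t → comb I D F z.2 t - comb I D F z.2 s ≤
        popCdf I D F G ν a t - popCdf I D F G ν a s + 2 * ε z.1 := by
    intro c hc
    have hcC : ¬ MonotoneOn (fun t => popCdf I D F G ν a t - comb I D F c t) I := fun h =>
      hc.2 (hCU ⟨hc.1, hM.comb_mem_limitFamily hc.1 h⟩)
    simp only [MonotoneOn] at hcC
    push Not at hcC
    obtain ⟨s, hs, t, ht, hst, hlt⟩ := hcC
    have hst' : s < t := lt_of_le_of_ne hst fun h => by
      rw [h] at hlt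
      exact lt_irrefl _ hlt
    obtain ⟨u, huT, hu⟩ := hT.exists_tendsto hs
    obtain ⟨v, hvT, hv⟩ := hT.exists_tendsto ht
    have hjoint : ∀ {w : ℕ → ℝ} {r : ℝ}, Tendsto w atTop (𝓝 r) →
        Tendsto (fun z : ℕ × (Fin L → ℝ) => comb I D F z.2 (w z.1)) (atTop ×ˢ 𝓝 c)
          (𝓝 (comb I D F c r)) := by
      intro w r hw
      refine tendsto_finsetSum _ fun k _ => Tendsto.mul ?_ ?_
      · exact ((continuous_apply k).tendsto c).comp tendsto_snd
      · exact ((hM.continuous_level k).tendsto r).comp (hw.comp tendsto_fst)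
    have hlim : Tendsto (fun z : ℕ × (Fin L → ℝ) =>
        popCdf I D F G ν a (v z.1) - popCdf I D F G ν a (u z.1) + 2 * ε z.1 -
          (comb I D F z.2 (v z.1) - comb I D F z.2 (u z.1))) (atTop ×ˢ 𝓝 c)
        (𝓝 (popCdf I D F G ν a t - popCdf I D F G ν a s + 2 * 0 -
          (comb I D F c t - comb I D F c s))) := by
      refine Tendsto.sub (Tendsto.add (Tendsto.sub ?_ ?_) ?_) ((hjoint hv).sub (hjoint hu))
      · exact (hM.continuousAt_popCdf ht).tendsto.comp (hv.comp tendsto_fst)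
      · exact (hM.continuousAt_popCdf hs).tendsto.comp (hu.comp tendsto_fst)
      · exact (hε.comp tendsto_fst).const_mul 2
    have huv : ∀ᶠ n in atTop, u n < v n := hu.eventually_lt hv hst'
    filter_upwards [hlim.eventually (gt_mem_nhds (show _ < (0 : ℝ) by linarith)),
      tendsto_fst.eventually (huT.and (hvT.and huv))] with z hz hz2 hall
    have := hall _ hz2.1 _ hz2.2.1 hz2.2.2
    linarith
  have hev : ∀ᶠ n in atTop, ∀ c ∈ Delta L \ U, ¬ ∀ s ∈ T n, ∀ t ∈ T n, s < t →
      comb I D F c t - comb I D F c s ≤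
        popCdf I D F G ν a t - popCdf I D F G ν a s + 2 * ε n := by
    have h := hK.mem_prod_nhdsSet_of_forall hloc
    exact (Filter.Eventually.curry h).mono fun n hn => hn.self_of_nhdsSet
  filter_upwards [hev] with n hn c hc hall
  by_contra hcon
  refine hn c ⟨hc, fun hcU => ?_⟩ hall
  obtain ⟨c', hc', hlt⟩ := Set.mem_iUnion₂.1 hcU
  exact hcon ⟨c', hc'.1, hc'.2, hlt⟩

end IsRegularModel

end Limit
-- Typical data: comparison of `M_n` with `m`, and location of the cutoff.
/-- The data avoid the intersection of all regions, and their empirical distribution is within `e`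
of `Q`. -/
def IsTypical {d : ℕ} (I : Set ℝ) (D : ℝ → Set (Obs d)) (Q : ℝ → ℝ) (e : ℝ) (x : ℕ → Obs d)
    (n : ℕ) : Prop :=
  (∀ i, x i ∉ ⋂ t ∈ I, D t) ∧ ∀ t ∈ I, |empCdf D x n t - Q t| ≤ e

section Cutoff

variable {d L : ℕ} {I : Set ℝ} {D : ℝ → Set (Obs d)} {F : Fin L → Measure (Obs d)}
  [∀ k, IsProbabilityMeasure (F k)] {G : Measure (Obs d)} [IsProbabilityMeasure G]
  {ν : Fin L → ℝ} {a : ℝ}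

lemma IsTypical.mono {Q : ℝ → ℝ} {e e' : ℝ} {x : ℕ → Obs d} {n : ℕ} (h : IsTypical I D Q e x n)
    (he : e ≤ e') : IsTypical I D Q e' x n :=
  ⟨h.1, fun t ht => (h.2 t ht).trans he⟩

namespace IsRegularModel

variable (hM : IsRegularModel I D F G ν a)
include hM

-- The margin `e` is a budget. Increments cost at most `2 * (e / 4)` in sampling error, and a shift
-- towards `ν` costs at most `θ ≤ e / 2`. The pointwise constraint costs less.
omit [IsProbabilityMeasure G] in
lemma mix_mem_dataFamily {e θ : ℝ} (hθ : θ ∈ Set.Icc (0 : ℝ) 1) (hθe : θ ≤ e / 2) {T : Finset ℝ}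
    (hT : (T : Set ℝ) ⊆ I) {x : ℕ → Obs d} {n : ℕ}
    (hx : IsTypical I D (popCdf I D F G ν a) (e / 4) x n) {c : Fin L → ℝ} (hc : c ∈ Delta L)
    (hcA : comb I D F c ∈ limitFamily I (popCdf I D F G ν a)) :
    comb I D F (fun k => (1 - θ) * c k + θ * ν k) ∈ dataFamily I D e T x n := by
  refine ⟨(hM.continuous_comb _).continuousOn, fun i _ => ?_, fun s hs t ht hst => ?_⟩
  · have hsI := (score_spec hM.family hM.ordConnected (hx.1 i)).1
    set s := score I D (x i)
    rw [comb_mix]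
    have h1 := comb_nonneg (D := D) (F := F) hc hsI
    have h2 := comb_le_one (D := D) (F := F) hM.prior_mem hsI
    have h3 := hcA.2.1 s hsI
    have h4 := (abs_le.1 (hx.2 s hsI)).1
    nlinarith [hθ.1, hθ.2]
  · have hsI : s ∈ I := hT hs
    have htI : t ∈ I := hT ht
    rw [comb_mix, comb_mix]
    have h0 := comb_monotoneOn (F := F) hM.family (fun k => (hc.1 k).1) hsI htI hst.le
    have h1 := comb_nonneg (D := D) (F := F) hM.prior_mem hsI
    have h2 := comb_le_one (D := D) (F := F) hM.prior_mem htI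
    have h3 := hcA.2.2 hsI htI hst.le
    have h4 := (abs_le.1 (hx.2 s hsI)).2
    have h5 := (abs_le.1 (hx.2 t htI)).1
    simp only at h3
    nlinarith [hθ.1, hθ.2]

omit [IsProbabilityMeasure G] in
lemma le_dataMax_mix {e θ : ℝ} (hθ : θ ∈ Set.Icc (0 : ℝ) 1) (hθe : θ ≤ e / 2) {T : Finset ℝ}
    (hT : (T : Set ℝ) ⊆ I) {x : ℕ → Obs d} {n : ℕ}
    (hx : IsTypical I D (popCdf I D F G ν a) (e / 4) x n) {c : Fin L → ℝ} (hc : c ∈ Delta L)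
    (hcA : comb I D F c ∈ limitFamily I (popCdf I D F G ν a)) {t : ℝ} (ht : t ∈ I) :
    (1 - θ) * comb I D F c t + θ * comb I D F ν t ≤ dataMax I D F e T x n t := by
  rw [← comb_mix]
  exact comb_le_dataMax (mix_mem_Delta hc hM.prior_mem hθ)
    (hM.mix_mem_dataFamily hθ hθe hT hx hc hcA) ht

omit [IsProbabilityMeasure G] in
lemma comb_le_dataMax_of_limit {e : ℝ} (he : 0 ≤ e) {T : Finset ℝ}
    (hT : (T : Set ℝ) ⊆ I) {x : ℕ → Obs d} {n : ℕ}
    (hx : IsTypical I D (popCdf I D F G ν a) (e / 4) x n) {c : Fin L → ℝ} (hc : c ∈ Delta L)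
    (hcA : comb I D F c ∈ limitFamily I (popCdf I D F G ν a)) {t : ℝ} (ht : t ∈ I) :
    comb I D F c t ≤ dataMax I D F e T x n t := by
  simpa using hM.le_dataMax_mix (θ := 0) (by simp) (by linarith) hT hx hc hcA ht

/-- Feasibility together with the sampling error gives increment constraints for `Q` with slack `ε n
+ 2 * (ε n / 4) ≤ 2 * ε n`, the slack allowed in `eventually_close`. -/
lemma eventually_dataMax_le {T : ℕ → Finset ℝ} (hT : IncreasinglyDense T I)
    (hTI : ∀ n, (T n : Set ℝ) ⊆ I) {ε : ℕ → ℝ} (hε : Tendsto ε atTop (𝓝 0)) {δ : ℝ}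
    (hδ : 0 < δ) :
    ∀ᶠ n in atTop, ∀ x : ℕ → Obs d, IsTypical I D (popCdf I D F G ν a) (ε n / 4) x n → 0 ≤ ε n →
      ∀ t ∈ I, dataMax I D F (ε n) (T n) x n t ≤ limitMax I D F G ν a t + δ := by
  filter_upwards [hM.eventually_close hT hε hδ] with n hn x hx hεn t ht
  refine dataMax_le (by linarith [hM.limitMax_nonneg ht]) fun c hc hmem => ?_
  obtain ⟨c', hc', hA, hlt⟩ := hn c hc fun s hs u hu hsu => by
    have h1 := hmem.2.2 s hs u hu hsu
    have h2 := (abs_le.1 (hx.2 s (hTI n hs))).1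
    have h3 := (abs_le.1 (hx.2 u (hTI n hu))).2
    linarith
  have h1 := comb_le_add (F := F) (D := D) c c' ht
  have h2 := comb_le_limitMax hc' hA ht
  linarith

variable {α : ℝ} (hα : α ∈ Set.Ioo (0 : ℝ) 1) {ε : ℕ → ℝ} (hε : ∀ n, 0 ≤ ε n) {T : ℕ → Finset ℝ}
  (hTI : ∀ n, (T n : Set ℝ) ⊆ I) (hε0 : Tendsto ε atTop (𝓝 0))
include hα hε hTI hε0

omit [∀ k, IsProbabilityMeasure (F k)] [IsProbabilityMeasure G] hM hα hε hTI hε0 in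
lemma _root_.CompositeNull.empCdf_le_max_div (x : ℕ → Obs d) (n : ℕ) (t : ℝ) :
    empCdf D x n t ≤ ((max (countIn D x n t) 1 : ℕ) : ℝ) / n := by
  unfold empCdf
  gcongr
  exact le_max_left _ _

/-- A point at which the limit criterion holds strictly is eventually a candidate. -/
lemma eventually_mem_candidates (hT : IncreasinglyDense T I) {t : ℝ} (ht : t ∈ I)
    (hlt : limitMax I D F G ν a t < α * popCdf I D F G ν a t) :
    ∀ᶠ n in atTop, ∀ x : ℕ → Obs d,
      IsTypical I D (popCdf I D F G ν a) ((1 - α) / 16 * ε n) x n →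
      t ∈ candidates I D F α (ε n) (T n) x n := by
  -- Half of the gap covers the excess of `M_n` over `m`, the other half the sampling error.
  set γ := α * popCdf I D F G ν a t - limitMax I D F G ν a t with hγ
  have hγ0 : 0 < γ := by linarith
  filter_upwards [hM.eventually_dataMax_le hT hTI hε0 (half_pos hγ0),
    hε0.eventually (gt_mem_nhds (half_pos hγ0))] with n hn hεn x hx
  have hρ : (1 - α) / 16 * ε n ≤ ε n / 4 := by nlinarith [hα.1, hε n]
  have h1 := hn x (hx.mono hρ) (hε n) t ht
  have h2 := (abs_le.1 (hx.2 t ht)).1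
  refine ⟨ht, ?_⟩
  refine le_trans ?_ (empCdf_le_max_div x n t)
  rw [div_le_iff₀ hα.1]
  have h3 : (1 - α) / 16 * ε n ≤ γ / 2 := by nlinarith [hα.1, hε n]
  nlinarith [hα.1, hα.2]

/-- Eventually there are no candidates to the right of a point to the right of which the limit
criterion fails. -/
lemma eventually_notMem_candidates {u : ℝ} (hu : u ∈ I) (hQu : 0 < popCdf I D F G ν a u)
    (hgt : ∀ t ∈ I, u ≤ t → α * popCdf I D F G ν a t < limitMax I D F G ν a t) :
    ∀ᶠ n in atTop, ∀ x : ℕ → Obs d,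
      IsTypical I D (popCdf I D F G ν a) ((1 - α) / 16 * ε n) x n →
      ∀ t ∈ candidates I D F α (ε n) (T n) x n, t < u := by
  have hα0 := hα.1
  have hα1 := hα.2
  -- The level `(3 + α) / 4` is halfway between `(1 + α) / 2` and `1`. To the right of `b`, `νᵀφ`
  -- thus exceeds by `(1 - α) / 4` any combination that is at most `(1 + α) / 2`.
  obtain ⟨b, hb, hbν⟩ := hM.exists_lt_comb_prior (γ := (3 + α) / 4) (by linarith)
  have hgap : ∃ δ > 0, ∀ t ∈ Set.Icc u b, α * popCdf I D F G ν a t + δ <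
      limitMax I D F G ν a t := by
    have hK : IsCompact (Set.Icc u b) := isCompact_Icc
    -- As a supremum of continuous functions `m` is lower semicontinuous: a single `c` witnesses the
    -- strict inequality near `t`.
    have hloc : ∀ t ∈ Set.Icc u b, ∀ᶠ z : ℝ × ℝ in 𝓝 (0, t),
        α * popCdf I D F G ν a z.2 + z.1 < limitMax I D F G ν a z.2 := by
      intro t ht
      have htI : t ∈ I := hM.ordConnected.out hu hb ht
      obtain ⟨c, hc, hcA, hlt⟩ := hM.exists_comb_of_lt_limitMax (hgt t htI ht.1)
      have h1 : ContinuousAt (fun z : ℝ × ℝ => α * popCdf I D F G ν a z.2 + z.1) (0, t) := by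
        refine ContinuousAt.add (ContinuousAt.mul continuousAt_const ?_) continuousAt_fst
        exact ContinuousAt.comp (f := Prod.snd) (hM.continuousAt_popCdf htI) continuousAt_snd
      have h2 : ContinuousAt (fun z : ℝ × ℝ => comb I D F c z.2) (0, t) :=
        ((hM.continuous_comb c).comp continuous_snd).continuousAt
      have h3 : ∀ᶠ z : ℝ × ℝ in 𝓝 (0, t), z.2 ∈ I :=
        continuousAt_snd.eventually (hM.isOpen.mem_nhds htI)
      filter_upwards [h1.eventually_lt h2 (by simpa using hlt), h3] with z hz hzI
      exact hz.trans_le (comb_le_limitMax hc hcA hzI)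
    have h := hK.eventually_forall_of_forall_eventually
      (P := fun δ t => α * popCdf I D F G ν a t + δ < limitMax I D F G ν a t) hloc
    have h' := (h.filter_mono (nhdsWithin_le_nhds (s := Set.Ioi 0))).and self_mem_nhdsWithin
    obtain ⟨δ, h1, h2⟩ := h'.exists
    exact ⟨δ, h2, h1⟩
  obtain ⟨δ, hδ, hgap⟩ := hgap
  set q := popCdf I D F G ν a u with hq
  have hinv : Tendsto (fun n : ℕ => 1 / (n : ℝ)) atTop (𝓝 0) := tendsto_one_div_atTop_nhds_zero_nat
  filter_upwards [hε0.eventually (gt_mem_nhds hδ), hε0.eventually (gt_mem_nhds (half_pos hQu)),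
    hε0.eventually (gt_mem_nhds one_pos), hinv.eventually (gt_mem_nhds (half_pos hQu)),
    eventually_gt_atTop 0] with n hεδ hεq hε1 hnq hn0 x hx t ht
  by_contra hcon
  rw [not_lt] at hcon
  have hn : (0 : ℝ) < n := by exact_mod_cast hn0
  have hρ : (1 - α) / 16 * ε n ≤ ε n / 4 := by nlinarith [hε n]
  have hx' := hx.mono hρ
  have htI := ht.1
  have hFQ := abs_le.1 (hx.2 t htI)
  have hQm := hM.monotoneOn_popCdf hu htI hcon
  -- At least one observation lies in `D t`, so the maximum with `1` in the criterion is inactive.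
  have hFpos : 1 / (n : ℝ) ≤ empCdf D x n t := by linarith [hε n, hFQ.1]
  have hmax : ((max (countIn D x n t) 1 : ℕ) : ℝ) / n = empCdf D x n t := by
    have : (1 : ℝ) ≤ countIn D x n t := by
      unfold empCdf at hFpos
      exact (div_le_div_iff_of_pos_right hn).1 hFpos
    rw [max_eq_left (by exact_mod_cast this)]
    rfl
  have hle := ht.2
  rw [hmax, div_le_iff₀ hα0] at hle
  suffices h : α * empCdf D x n t < dataMax I D F (ε n) (T n) x n t by linarith
  rcases le_or_gt b t with hbt | hbt
  -- Either some `cᵀφ t` exceeds `(1 + α) / 2 > α`, which already beats `α * empCdf ≤ α`, or every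
  -- limit combination leaves room to be raised by mixing with `ν`.
  · by_cases hA : ∃ c ∈ Delta L, comb I D F c ∈ limitFamily I (popCdf I D F G ν a) ∧
        (1 + α) / 2 < comb I D F c t
    · obtain ⟨c, hc, hcA, hlt⟩ := hA
      have h1 := hM.comb_le_dataMax_of_limit (hε n) (hTI n) hx' hc hcA htI
      have h2 := empCdf_le_one (D := D) x n t
      nlinarith
    · push Not at hA
      obtain ⟨c, hc, hcA, hlt⟩ := hM.exists_comb_of_lt_limitMax (hgt t htI hcon)
      have h1 := hM.le_dataMax_mix (θ := ε n / 2) ⟨by linarith [hε n], by linarith⟩ le_rfl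
        (hTI n) hx' hc hcA htI
      have h2 := hA c hc hcA
      have h3 := hbν t htI hbt
      -- Mixing gains `(1 - α) / 8 * ε n`, twice the allowed deviation. This is the reason for the
      -- constant `(1 - α) / 16` in the typical event.
      have h4 : ε n / 2 * ((1 - α) / 4) ≤ ε n / 2 * (comb I D F ν t - comb I D F c t) :=
        mul_le_mul_of_nonneg_left (by linarith) (by linarith [hε n])
      have h5 : α * empCdf D x n t ≤ α * popCdf I D F G ν a t + (1 - α) / 16 * ε n := by
        have : 0 ≤ (1 - α) / 16 * ε n := mul_nonneg (by linarith) (hε n)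
        nlinarith [hFQ.2]
      have h6 : 0 ≤ (1 - α) * ε n := mul_nonneg (by linarith) (hε n)
      linarith
  · have h1 := hgap t ⟨hcon, hbt.le⟩
    obtain ⟨c, hc, hcA, hlt⟩ := hM.exists_comb_of_lt_limitMax h1
    have h2 := hM.comb_le_dataMax_of_limit (hε n) (hTI n) hx' hc hcA htI
    have h5 : α * empCdf D x n t ≤ α * popCdf I D F G ν a t + ε n := by
      have : 0 ≤ (1 - α) / 16 * ε n := mul_nonneg (by linarith) (hε n)
      nlinarith [hFQ.2, hε n]
    linarith

/-- On typical data the cutoff is eventually close to `t_*`. -/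
lemma eventually_cutoff_mem (hT : IncreasinglyDense T I) {tstar : ℝ}
    (htstar : IsLUB {t | t ∈ I ∧ limitMax I D F G ν a t ≤ α * popCdf I D F G ν a t} tstar)
    (htstarI : tstar ∈ I)
    (hA : ∃ t₀ < tstar, ∀ t ∈ Set.Ioo t₀ tstar, t ∈ I →
      limitMax I D F G ν a t < α * popCdf I D F G ν a t) {r : ℝ} (hr : 0 < r) :
    ∃ t₁ ∈ I, ∃ t₂ ∈ I, tstar - r < t₁ ∧ t₁ < tstar ∧ tstar < t₂ ∧ t₂ < tstar + r ∧
      0 < popCdf I D F G ν a t₁ ∧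
      ∀ᶠ n in atTop, ∀ x : ℕ → Obs d,
        IsTypical I D (popCdf I D F G ν a) ((1 - α) / 16 * ε n) x n →
        (candidates I D F α (ε n) (T n) x n).Nonempty ∧
          (t₁ : EReal) ≤ cutoff I D F α (ε n) (T n) x n ∧
          cutoff I D F α (ε n) (T n) x n ≤ (t₂ : EReal) := by
  obtain ⟨t₀, ht₀, hA⟩ := hA
  have hnh := hM.isOpen.mem_nhds htstarI
  obtain ⟨t₁, ⟨ht₁I, h1a, h1b⟩, h1c⟩ : ∃ t, (t ∈ I ∧ t₀ < t ∧ tstar - r < t) ∧ t < tstar := by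
    have h : ∀ᶠ t in 𝓝[<] tstar, t ∈ I ∧ t₀ < t ∧ tstar - r < t := nhdsWithin_le_nhds
      (Filter.inter_mem hnh (Filter.inter_mem (lt_mem_nhds ht₀) (lt_mem_nhds (by linarith))))
    exact (h.and self_mem_nhdsWithin).exists
  obtain ⟨t₂, ⟨ht₂I, h2b⟩, h2c⟩ : ∃ t, (t ∈ I ∧ t < tstar + r) ∧ tstar < t := by
    have h : ∀ᶠ t in 𝓝[>] tstar, t ∈ I ∧ t < tstar + r := nhdsWithin_le_nhds
      (Filter.inter_mem hnh (gt_mem_nhds (by linarith)))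
    exact (h.and self_mem_nhdsWithin).exists
  have hlt := hA t₁ ⟨h1a, h1c⟩ ht₁I
  have hQ1 : 0 < popCdf I D F G ν a t₁ := by
    have := (hM.limitMax_nonneg ht₁I).trans_lt hlt
    exact (mul_pos_iff_of_pos_left hα.1).1 this
  refine ⟨t₁, ht₁I, t₂, ht₂I, h1b, h1c, h2c, h2b, hQ1, ?_⟩
  have hQ2 : 0 < popCdf I D F G ν a t₂ :=
    hQ1.trans_le (hM.monotoneOn_popCdf ht₁I ht₂I (h1c.trans h2c).le)
  have hgt : ∀ t ∈ I, t₂ ≤ t → α * popCdf I D F G ν a t < limitMax I D F G ν a t := by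
    intro t ht htt
    by_contra hcon
    have := htstar.1 ⟨ht, not_lt.1 hcon⟩
    linarith
  filter_upwards [hM.eventually_mem_candidates hα hε hTI hε0 hT ht₁I hlt,
    hM.eventually_notMem_candidates hα hε hTI hε0 ht₂I hQ2 hgt] with n h1 h2 x hx
  have hne : (candidates I D F α (ε n) (T n) x n).Nonempty := ⟨t₁, h1 x hx⟩
  refine ⟨hne, ?_, ?_⟩
  · rw [cutoff, if_pos hne]
    exact le_sSup ⟨t₁, h1 x hx, rfl⟩
  · rw [cutoff, if_pos hne]
    refine sSup_le ?_
    rintro _ ⟨t, ht, rfl⟩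
    exact EReal.coe_le_coe_iff.2 (h2 x hx t ht).le

omit hM hα hε hTI hε0 in
/-- The limit criterion holds at `t_*`, as far as the true nulls are concerned. -/
lemma true_le_at_tstar (hM : IsRegularModel I D F G ν a) {tstar : ℝ}
    (htstar : IsLUB {t | t ∈ I ∧ limitMax I D F G ν a t ≤ α * popCdf I D F G ν a t} tstar)
    (htstarI : tstar ∈ I) (hne : {t | t ∈ I ∧ limitMax I D F G ν a t ≤
      α * popCdf I D F G ν a t}.Nonempty) :
    (1 - a) * comb I D F ν tstar ≤ α * popCdf I D F G ν a tstar := by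
  obtain ⟨hc, hcA⟩ := hM.comb_true_mem
  have hcl := htstar.mem_closure hne
  have := mem_closure_iff_frequently.1 hcl
  by_contra hcon
  rw [not_le, ← comb_smul] at hcon
  have h1 : ContinuousAt (fun t => α * popCdf I D F G ν a t) tstar :=
    (hM.continuousAt_popCdf htstarI).const_mul _
  have h2 := (hM.continuous_comb fun k => (1 - a) * ν k).continuousAt (x := tstar)
  obtain ⟨t, ⟨htI, ht⟩, hlt⟩ := (this.and_eventually (h1.eventually_lt h2 hcon)).exists
  have := comb_le_limitMax hc hcA htI
  linarith

end IsRegularModel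

end Cutoff

/-! ### Measurability of random feasibility problems and of the false discovery proportion. -/

section Measurability

/-- The existence in a compact set of a solution of a random inequality is a measurable event. -/
lemma measurableSet_exists_le_zero {Ω E : Type*} [MeasurableSpace Ω] [PseudoMetricSpace E]
    {K : Set E} (hK : IsCompact K) {g : Ω → E → ℝ} (hc : ∀ ω, Continuous (g ω))
    (hm : ∀ c, Measurable fun ω => g ω c) : MeasurableSet {ω | ∃ c ∈ K, g ω c ≤ 0} := by
  have := isCompact_iff_compactSpace.1 hK
  obtain ⟨S, hScount, hS⟩ := TopologicalSpace.exists_countable_dense K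
  -- The minimum of `g ω` over `K` is attained and equals the infimum over a countable dense subset.
  have heq : {ω | ∃ c ∈ K, g ω c ≤ 0} =
      ⋂ m : ℕ, ⋃ c ∈ S, {ω | g ω (c : E) < 1 / ((m : ℝ) + 1)} := by
    ext ω
    simp only [Set.mem_iInter, Set.mem_iUnion]
    have hcont : Continuous fun c : K => g ω c := (hc ω).comp continuous_subtype_val
    constructor
    · rintro ⟨c, hcK, hle⟩ m
      obtain ⟨c', hc', hlt⟩ := hS.exists_mem_open
        (isOpen_lt hcont (continuous_const (y := 1 / ((m : ℝ) + 1))))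
        ⟨⟨c, hcK⟩, hle.trans_lt (by positivity)⟩
      exact ⟨c', hc', hlt⟩
    · intro h
      obtain ⟨c₁, -⟩ := h 0
      obtain ⟨c₀, hc₀, hmin⟩ := hK.exists_isMinOn ⟨c₁, c₁.2⟩ (hc ω).continuousOn
      refine ⟨c₀, hc₀, le_of_forall_pos_le_add fun γ hγ => ?_⟩
      obtain ⟨m, hm⟩ := exists_nat_one_div_lt hγ
      obtain ⟨c, -, hlt⟩ := h m
      have h1 : g ω c₀ ≤ g ω c := hmin c.2
      have h2 : g ω c < 1 / ((m : ℝ) + 1) := hlt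
      linarith
  rw [heq]
  refine MeasurableSet.iInter fun m => MeasurableSet.biUnion hScount fun c _ => ?_
  exact measurableSet_lt (hm c) measurable_const

lemma measurable_fdp {Ω : Type*} [MeasurableSpace Ω] {L : ℕ} {η : ℕ → Ω → Fin L ⊕ Unit}
    (hη : ∀ i, Measurable (η i)) {S : Ω → Finset ℕ} {n : ℕ} (hSn : ∀ ω, S ω ⊆ Finset.range n)
    (hS : ∀ i, MeasurableSet {ω | i ∈ S ω}) :
    Measurable fun ω => fdp (fun i => η i ω) (S ω) := by
  classical
  have hleft : ∀ i, MeasurableSet {ω | (η i ω).isLeft = true} := fun i =>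
    hη i (show MeasurableSet {l : Fin L ⊕ Unit | l.isLeft = true} from
      measurableSet_sum_iff.2 ⟨.of_discrete, .of_discrete⟩)
  have hcard : ∀ (p : ℕ → Ω → Prop) [∀ i ω, Decidable (p i ω)], (∀ i, MeasurableSet {ω | p i ω}) →
      Measurable fun ω => ((S ω).filter fun i => p i ω).card := by
    intro p _ hp
    have : (fun ω => ((S ω).filter fun i => p i ω).card) =
        fun ω => ∑ i ∈ Finset.range n, if i ∈ S ω ∧ p i ω then 1 else 0 := by
      ext ω
      rw [← Finset.card_filter]
      congr 1
      ext i
      simp only [Finset.mem_filter]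
      exact ⟨fun h => ⟨hSn ω h.1, h⟩, fun h => h.2⟩
    rw [this]
    refine Finset.measurable_fun_sum _ fun i _ => ?_
    exact Measurable.ite ((hS i).inter (hp i)) measurable_const measurable_const
  have h1 := hcard (fun i ω => (η i ω).isLeft = true) hleft
  have h2 : Measurable fun ω => (S ω).card := by
    simpa using hcard (fun _ _ => True) fun _ => by simp
  have hcast : Measurable fun k : ℕ => (k : ℝ) := measurable_from_nat
  refine Measurable.div ?_ ?_
  · exact hcast.comp h1
  · exact hcast.comp (h2.max measurable_const)

end Measurability

/-! ### A measurable description of the rejected set. -/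

section Rejected

variable {d L : ℕ} {I : Set ℝ} {D : ℝ → Set (Obs d)} {F : Fin L → Measure (Obs d)}
  [∀ k, IsProbabilityMeasure (F k)]

lemma dataMax_monotoneOn (hD : IsRegionFamily I D) {e : ℝ} {T : Finset ℝ} {x : ℕ → Obs d}
    {n : ℕ} : MonotoneOn (dataMax I D F e T x n) I := by
  intro s hs t ht hst
  -- The sign of `e` is unrestricted, so there may be no feasible combination and the supremum may
  -- be the default value `0`. Nonnegativity of the right-hand side covers that case.
  refine Real.sSup_le ?_ (Real.sSup_nonneg ?_)
  · rintro y ⟨c, hc, hmem, rfl⟩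
    exact (comb_monotoneOn hD (fun k => (hc.1 k).1) hs ht hst).trans (comb_le_dataMax hc hmem ht)
  · rintro y ⟨c, hc, hmem, rfl⟩
    exact comb_nonneg hc ht

/-- Rejection is determined by the candidates among the scores. -/
lemma mem_rejected_iff (hD : IsRegionFamily I D) (hI : I.OrdConnected)
    (hφ : ∀ k, Continuous (level I D (F k))) {α : ℝ} (hα : 0 < α) {e : ℝ} {T : Finset ℝ}
    {x : ℕ → Obs d} (hx : ∀ i, x i ∉ ⋂ t ∈ I, D t) {n i : ℕ} (hi : i < n) :
    i ∈ rejected I D F α e T x n ↔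
      ∃ j < n, score I D (x i) ≤ score I D (x j) ∧
        score I D (x j) ∈ candidates I D F α e T x n := by
  classical
  have hs := fun j => score_spec hD hI (hx j)
  set s := fun j => score I D (x j) with hsdef
  set A := candidates I D F α e T x n with hA
  simp only [rejected, Finset.mem_filter, Finset.mem_range, hi, true_and]
  constructor
  · rintro ⟨hne, hle⟩
    rw [cutoff, if_pos hne] at hle
    -- Given a candidate `t ≥ s i`, move left to the largest score not exceeding `t`: the count is
    -- unchanged and `M_n` can only decrease, so that score is a candidate.
    by_cases hex : ∃ t ∈ A, s i ≤ t
    · obtain ⟨t, htA, hit⟩ := hex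
      obtain ⟨j, hj, hmax⟩ := Finset.exists_max_image
        ((Finset.range n).filter fun j => s j ≤ t) s ⟨i, by simp [hi, hit]⟩
      rw [Finset.mem_filter, Finset.mem_range] at hj
      refine ⟨j, hj.1, hmax i (by simp [hi, hit]), (hs j).1, ?_⟩
      have hcount : countIn D x n (s j) = countIn D x n t := by
        unfold countIn
        congr 1
        refine Finset.filter_congr fun l hl => ?_
        rw [(hs l).2 _ (hs j).1, (hs l).2 _ htA.1]
        exact ⟨fun h => h.trans hj.2, fun h => hmax l (Finset.mem_filter.2 ⟨hl, h⟩)⟩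
      rw [hcount]
      refine le_trans ?_ htA.2
      have := dataMax_monotoneOn (F := F) (e := e) (T := T) (x := x) (n := n) hD (hs j).1 htA.1 hj.2
      gcongr
    · push Not at hex
      refine ⟨i, hi, le_rfl, (hs i).1, ?_⟩
      -- Otherwise `s i` is itself the supremum of the candidates. The inequality for each feasible
      -- combination passes to it by continuity, so `j = i` works.
      have hlub : IsLUB A (s i) := by
        refine ⟨fun t ht => (hex t ht).le, fun v hv => ?_⟩
        rw [← EReal.coe_le_coe_iff]
        refine hle.trans (sSup_le ?_)
        rintro _ ⟨t, ht, rfl⟩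
        exact EReal.coe_le_coe_iff.2 (hv ht)
      rw [div_le_iff₀ hα]
      refine dataMax_le (by positivity) fun c hc hmem => ?_
      have hcl : IsClosed {t | comb I D F c t ≤
          ((max (countIn D x n (s i)) 1 : ℕ) : ℝ) / n * α} :=
        isClosed_le (continuous_finsetSum _ fun k _ => (hφ k).const_mul _) continuous_const
      refine closure_minimal ?_ hcl (hlub.mem_closure hne)
      intro t ht
      have h1 := comb_le_dataMax hc hmem ht.1
      have h2 := (div_le_iff₀ hα).1 ht.2
      have h3 := countIn_mono hD x n ht.1 (hs i).1 (hex t ht).le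
      refine (h1.trans h2).trans ?_
      gcongr
  · rintro ⟨j, hj, hij, hjA⟩
    refine ⟨⟨_, hjA⟩, ?_⟩
    rw [cutoff, if_pos ⟨_, hjA⟩]
    exact (EReal.coe_le_coe_iff.2 hij).trans (le_sSup ⟨_, hjA, rfl⟩)

/-- Only the finitely many events "the score of `X j` is a candidate" matter, by `mem_rejected_iff`.
Such an event fails when some feasible `c` in the compact set `Delta L` exceeds a bound. The
measurable version `S` is required to agree only off the core. -/
lemma exists_measurable_rejected {Ω : Type*} [MeasurableSpace Ω]
    (hD : IsRegionFamily I D) (hIo : IsOpen I) (hI : I.OrdConnected)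
    (hφ : ∀ k, Continuous (level I D (F k))) {α : ℝ} (hα : 0 < α) (e : ℝ) {T : Finset ℝ}
    (hT : (T : Set ℝ) ⊆ I) {X : ℕ → Ω → Obs d} (hX : ∀ i, Measurable (X i)) (n : ℕ) :
    ∃ S : Ω → Finset ℕ, (∀ ω, S ω ⊆ Finset.range n) ∧ (∀ i, MeasurableSet {ω | i ∈ S ω}) ∧
      ∀ ω, (∀ i, X i ω ∉ ⋂ t ∈ I, D t) →
        rejected I D F α e T (fun i => X i ω) n = S ω := by
  classical
  let s : ℕ → Ω → ℝ := fun i ω => score I D (X i ω)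
  have hs : ∀ i, Measurable (s i) := fun i => (measurable_score hD hIo hI).comp (hX i)
  -- Comparing scores avoids membership in the random region `D (s i ω)`; off the core the two
  -- counts agree.
  let N : ℕ → Ω → ℝ := fun i ω => ∑ l ∈ Finset.range n, if s l ω ≤ s i ω then 1 else 0
  have hN : ∀ i, Measurable (N i) := fun i => Finset.measurable_fun_sum _ fun l _ =>
    Measurable.ite (measurableSet_le (hs l) (hs i)) measurable_const measurable_const
  have hcomb : ∀ c : Fin L → ℝ, Continuous (comb I D F c) := fun c =>
    continuous_finsetSum _ fun k _ => (hφ k).const_mul _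
  have hemp : ∀ t ∈ T, Measurable fun ω => empCdf D (fun i => X i ω) n t := by
    intro t ht
    simp only [empCdf, countIn_eq_sum]
    refine Measurable.div_const (Finset.measurable_fun_sum _ fun i _ => ?_) _
    exact (measurable_const.indicator (hD.measurableSet t (hT ht))).comp (hX i)
  let feas : Ω → (Fin L → ℝ) → Prop := fun ω c =>
    (∀ i < n, comb I D F c (s i ω) ≤ N i ω / n + e) ∧
    ∀ t₁ ∈ T, ∀ t₂ ∈ T, t₁ < t₂ → comb I D F c t₂ - comb I D F c t₁ - e ≤
      empCdf D (fun i => X i ω) n t₂ - empCdf D (fun i => X i ω) n t₁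
  let bd : ℕ → Ω → ℝ := fun j ω => max (N j ω) 1 / n * α
  have hbd : ∀ j, Measurable (bd j) := fun j =>
    (((hN j).max measurable_const).div_const _).mul_const _
  let E : ℕ → Set Ω := fun j => {ω | ∀ c ∈ Delta L, feas ω c → comb I D F c (s j ω) ≤ bd j ω}
  have hE : ∀ j, MeasurableSet (E j) := by
    intro j
    -- A sum of positive parts is nonpositive exactly when all the constraints hold. The term `1 /
    -- (m + 1)` replaces the strict excess over the bound by a closed condition, with a union over
    -- `m`.
    let g : ℕ → Ω → (Fin L → ℝ) → ℝ := fun m ω c =>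
      ∑ i ∈ Finset.range n, max (comb I D F c (s i ω) - (N i ω / n + e)) 0 +
      ∑ t₁ ∈ T, ∑ t₂ ∈ T, (if t₁ < t₂ then max (comb I D F c t₂ - comb I D F c t₁ - e -
        (empCdf D (fun i => X i ω) n t₂ - empCdf D (fun i => X i ω) n t₁)) 0 else 0) +
      max (bd j ω + 1 / ((m : ℝ) + 1) - comb I D F c (s j ω)) 0
    have hg : ∀ m ω c, g m ω c ≤ 0 ↔
        feas ω c ∧ bd j ω + 1 / ((m : ℝ) + 1) ≤ comb I D F c (s j ω) := by
      intro m ω c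
      have p1 : ∀ i ∈ Finset.range n, 0 ≤ max (comb I D F c (s i ω) - (N i ω / n + e)) 0 :=
        fun _ _ => le_max_right _ _
      have p2' : ∀ t₁ ∈ T, ∀ t₂ ∈ T, 0 ≤ (if t₁ < t₂ then max (comb I D F c t₂ - comb I D F c t₁ -
          e - (empCdf D (fun i => X i ω) n t₂ - empCdf D (fun i => X i ω) n t₁)) 0 else 0) := by
        intro t₁ _ t₂ _
        split_ifs
        · exact le_max_right _ _
        · exact le_rfl
      have p2 := fun t₁ ht₁ => Finset.sum_nonneg (p2' t₁ ht₁)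
      have p3 : 0 ≤ max (bd j ω + 1 / ((m : ℝ) + 1) - comb I D F c (s j ω)) 0 := le_max_right _ _
      have q1 := Finset.sum_nonneg p1
      have q2 := Finset.sum_nonneg p2
      constructor
      · intro h
        have z1 := (Finset.sum_eq_zero_iff_of_nonneg p1).1 (by linarith)
        have z2 := (Finset.sum_eq_zero_iff_of_nonneg p2).1 (by linarith)
        refine ⟨⟨fun i hi => ?_, fun t₁ h₁ t₂ h₂ hlt => ?_⟩, ?_⟩
        · exact sub_nonpos.1 (max_eq_right_iff.1 (z1 i (Finset.mem_range.2 hi)))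
        · have z := (Finset.sum_eq_zero_iff_of_nonneg (p2' t₁ h₁)).1 (z2 t₁ h₁) t₂ h₂
          rw [if_pos hlt] at z
          exact sub_nonpos.1 (max_eq_right_iff.1 z)
        · exact sub_nonpos.1 (max_eq_right_iff.1 (le_antisymm (by linarith) p3))
      · rintro ⟨⟨h1, h2⟩, h3⟩
        refine le_of_eq ?_
        simp only [g]
        rw [Finset.sum_eq_zero fun i hi => max_eq_right
            (sub_nonpos.2 (h1 i (Finset.mem_range.1 hi))),
          Finset.sum_eq_zero fun t₁ ht₁ => Finset.sum_eq_zero fun t₂ ht₂ => ?_,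
          max_eq_right (sub_nonpos.2 h3)]
        · simp
        · split_ifs with hlt
          · exact max_eq_right (sub_nonpos.2 (h2 t₁ ht₁ t₂ ht₂ hlt))
          · rfl
    have hcompl : (E j)ᶜ = ⋃ m : ℕ, {ω | ∃ c ∈ Delta L, g m ω c ≤ 0} := by
      ext ω
      simp only [Set.mem_compl_iff, Set.mem_iUnion]
      constructor
      · intro h
        have h' : ¬ ∀ c ∈ Delta L, feas ω c → comb I D F c (s j ω) ≤ bd j ω := h
        push Not at h'
        obtain ⟨c, hc, hf, hlt⟩ := h'
        obtain ⟨m, hm⟩ := exists_nat_one_div_lt (sub_pos.2 hlt)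
        exact ⟨m, c, hc, (hg m ω c).2 ⟨hf, by linarith⟩⟩
      · rintro ⟨m, c, hc, h⟩ hE
        obtain ⟨hf, hle⟩ := (hg m ω c).1 h
        have := hE c hc hf
        have : (0 : ℝ) < 1 / ((m : ℝ) + 1) := by positivity
        linarith
    refine MeasurableSet.of_compl ?_
    rw [hcompl]
    refine MeasurableSet.iUnion fun m => measurableSet_exists_le_zero isCompact_Delta ?_ ?_
    · intro ω
      refine Continuous.add (Continuous.add ?_ ?_) ?_
      · exact continuous_finsetSum _ fun i _ =>
          ((continuous_comb_coeff _).sub continuous_const).max continuous_const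
      · refine continuous_finsetSum _ fun t₁ _ => continuous_finsetSum _ fun t₂ _ => ?_
        split_ifs
        · exact ((((continuous_comb_coeff _).sub (continuous_comb_coeff _)).sub
            continuous_const).sub continuous_const).max continuous_const
        · exact continuous_const
      · exact (continuous_const.sub (continuous_comb_coeff _)).max continuous_const
    · intro c
      refine Measurable.add (Measurable.add ?_ ?_) ?_
      · refine Finset.measurable_fun_sum _ fun i _ => Measurable.max ?_ measurable_const
        exact ((hcomb c).measurable.comp (hs i)).sub (((hN i).div_const _).add_const _)
      · refine Finset.measurable_fun_sum _ fun t₁ h₁ => Finset.measurable_fun_sum _ fun t₂ h₂ => ?_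
        split_ifs
        · exact (measurable_const.sub ((hemp t₂ h₂).sub (hemp t₁ h₁))).max measurable_const
        · exact measurable_const
      · exact (((hbd j).add_const _).sub ((hcomb c).measurable.comp (hs j))).max measurable_const
  refine ⟨fun ω => (Finset.range n).filter fun i => ∃ j < n, s i ω ≤ s j ω ∧ ω ∈ E j,
    fun ω => Finset.filter_subset _ _, fun i => ?_, fun ω hω => ?_⟩
  · have : {ω | i ∈ (Finset.range n).filter fun i => ∃ j < n, s i ω ≤ s j ω ∧ ω ∈ E j} =
        {_ω | i < n} ∩ ⋃ j : ℕ, ⋃ (_ : j < n), {ω | s i ω ≤ s j ω} ∩ E j := by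
      ext ω
      simp [and_left_comm]
    rw [this]
    refine (MeasurableSet.const _).inter ?_
    exact MeasurableSet.iUnion fun j => MeasurableSet.iUnion fun _ =>
      (measurableSet_le (hs i) (hs j)).inter (hE j)
  · have hsp := fun i => score_spec hD hI (hω i)
    have hcount : ∀ i, (countIn D (fun i => X i ω) n (s i ω) : ℝ) = N i ω := by
      intro i
      rw [countIn_eq_sum]
      refine Finset.sum_congr rfl fun l _ => ?_
      rw [Set.indicator_apply]
      exact if_congr ((hsp l).2 _ (hsp i).1) rfl rfl
    have hfeas : ∀ c, comb I D F c ∈ dataFamily I D e T (fun i => X i ω) n ↔ feas ω c := by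
      intro c
      have h1 : ∀ i, empCdf D (fun i => X i ω) n (s i ω) = N i ω / n := fun i => by
        rw [empCdf, hcount]
      simp only [feas, ← h1]
      exact ⟨fun h => h.2, fun h => ⟨(hcomb c).continuousOn, h⟩⟩
    have hcand : ∀ j, s j ω ∈ candidates I D F α e T (fun i => X i ω) n ↔ ω ∈ E j := by
      intro j
      have hb : ((max (countIn D (fun i => X i ω) n (s j ω)) 1 : ℕ) : ℝ) / n * α = bd j ω := by
        simp only [bd, ← hcount]
        push_cast
        rfl
      constructor
      · intro h c hc hf
        have h2 := (div_le_iff₀ hα).1 h.2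
        rw [hb] at h2
        exact (comb_le_dataMax hc ((hfeas c).2 hf) (hsp j).1).trans h2
      · intro h
        refine ⟨(hsp j).1, ?_⟩
        rw [div_le_iff₀ hα, hb]
        refine dataMax_le ?_ fun c hc hmem => h c hc ((hfeas c).1 hmem)
        rw [← hb]
        positivity
    ext i
    rw [Finset.mem_filter, Finset.mem_range]
    by_cases hi : i < n
    · rw [mem_rejected_iff hD hI hφ hα hω hi]
      simp only [hi, true_and]
      refine exists_congr fun j => and_congr_right fun _ => and_congr_right fun _ => hcand j
    · simp [rejected, hi]

lemma fdp_nonneg (lab : ℕ → Fin L ⊕ Unit) (S : Finset ℕ) : 0 ≤ fdp lab S := by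
  unfold fdp
  positivity

lemma fdp_le_one (lab : ℕ → Fin L ⊕ Unit) (S : Finset ℕ) : fdp lab S ≤ 1 := by
  refine div_le_one_of_le₀ ?_ (by positivity)
  exact_mod_cast (Finset.card_filter_le _ _).trans (le_max_left _ _)

end Rejected

/-! ### Squeezing a rejected set between two threshold rules. -/

section Counting

variable {d L : ℕ} {I : Set ℝ} {D : ℝ → Set (Obs d)} {F : Fin L → Measure (Obs d)}

/-- The indices of the observations in `D t`. -/
noncomputable def indicesIn (D : ℝ → Set (Obs d)) (x : ℕ → Obs d) (n : ℕ) (t : ℝ) : Finset ℕ :=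
  open Classical in (Finset.range n).filter fun i => x i ∈ D t

lemma card_indicesIn (x : ℕ → Obs d) (n : ℕ) (t : ℝ) :
    (indicesIn D x n t).card = countIn D x n t := rfl

lemma mem_indicesIn {x : ℕ → Obs d} {n : ℕ} {t : ℝ} {i : ℕ} :
    i ∈ indicesIn D x n t ↔ i < n ∧ x i ∈ D t := by simp [indicesIn]

lemma rejectedAt_eq (hD : IsRegionFamily I D) (hI : I.OrdConnected) {x : ℕ → Obs d}
    (hx : ∀ i, x i ∉ ⋂ t ∈ I, D t) (n : ℕ) {t : ℝ} (ht : t ∈ I) :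
    rejectedAt I D t x n = indicesIn D x n t := by
  ext i
  simp [rejectedAt, mem_indicesIn, (score_spec hD hI (hx i)).2 t ht]

variable {α e : ℝ} {T : Finset ℝ} {x : ℕ → Obs d} {n : ℕ} {t₁ t₂ : ℝ}

lemma indicesIn_subset_rejected (hD : IsRegionFamily I D) (hI : I.OrdConnected)
    (hx : ∀ i, x i ∉ ⋂ t ∈ I, D t) (ht₁ : t₁ ∈ I)
    (hne : (candidates I D F α e T x n).Nonempty)
    (h₁ : (t₁ : EReal) ≤ cutoff I D F α e T x n) :
    indicesIn D x n t₁ ⊆ rejected I D F α e T x n := by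
  intro i hi
  rw [mem_indicesIn, (score_spec hD hI (hx i)).2 t₁ ht₁] at hi
  simp only [rejected, Finset.mem_filter, Finset.mem_range]
  exact ⟨hi.1, hne, (EReal.coe_le_coe_iff.2 hi.2).trans h₁⟩

lemma rejected_subset_indicesIn (hD : IsRegionFamily I D) (hI : I.OrdConnected)
    (hx : ∀ i, x i ∉ ⋂ t ∈ I, D t) (ht₂ : t₂ ∈ I)
    (h₂ : cutoff I D F α e T x n ≤ (t₂ : EReal)) :
    rejected I D F α e T x n ⊆ indicesIn D x n t₂ := by
  intro i hi
  simp only [rejected, Finset.mem_filter, Finset.mem_range] at hi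
  rw [mem_indicesIn, (score_spec hD hI (hx i)).2 t₂ ht₂]
  exact ⟨hi.1, EReal.coe_le_coe_iff.1 (hi.2.2.trans h₂)⟩

lemma card_symmDiff_le {S S' A B : Finset ℕ} (h₁ : A ⊆ S) (h₂ : S ⊆ B) (h₁' : A ⊆ S')
    (h₂' : S' ⊆ B) : ((symmDiff S S').card : ℝ) ≤ B.card - A.card := by
  have hsub : symmDiff S S' ⊆ B \ A := by
    intro i hi
    rw [Finset.mem_symmDiff] at hi
    rw [Finset.mem_sdiff]
    rcases hi with ⟨h, h'⟩ | ⟨h, h'⟩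
    · exact ⟨h₂ h, fun hA => h' (h₁' hA)⟩
    · exact ⟨h₂' h, fun hA => h' (h₁ hA)⟩
  have h := Finset.card_le_card hsub
  have h' := Finset.card_sdiff_add_card_eq_card (h₁.trans h₂)
  rw [le_sub_iff_add_le]
  exact_mod_cast (by omega : (symmDiff S S').card + A.card ≤ B.card)

/-- A bound on the false discovery proportion of a set of rejections squeezed between two rules. -/
lemma fdp_le {lab : ℕ → Fin L ⊕ Unit} {S : Finset ℕ} (h₁ : indicesIn D x n t₁ ⊆ S)
    (h₂ : S ⊆ indicesIn D x n t₂) {b : ℝ} (hb : 0 ≤ b)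
    (hle : ∑ i ∈ Finset.range n, ({l | l.isLeft} ×ˢ D t₂ : Set ((Fin L ⊕ Unit) × Obs d)).indicator
      (fun _ => (1 : ℝ)) (lab i, x i) ≤ b * countIn D x n t₁) : fdp lab S ≤ b := by
  classical
  unfold fdp
  rw [div_le_iff₀ (by positivity)]
  have hcard : ((S.filter fun i => (lab i).isLeft).card : ℝ) ≤ ∑ i ∈ Finset.range n,
      ({l | l.isLeft} ×ˢ D t₂ : Set ((Fin L ⊕ Unit) × Obs d)).indicator
        (fun _ => (1 : ℝ)) (lab i, x i) := by
    simp only [Set.indicator_apply]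
    rw [Finset.sum_boole]
    refine Nat.cast_le.2 (Finset.card_le_card fun i hi => ?_)
    rw [Finset.mem_filter] at hi
    have h := mem_indicesIn.1 (h₂ hi.1)
    exact Finset.mem_filter.2 ⟨Finset.mem_range.2 h.1, hi.2, h.2⟩
  refine hcard.trans (hle.trans (mul_le_mul_of_nonneg_left ?_ hb))
  refine Nat.cast_le.2 (le_max_of_le_left ?_)
  exact Finset.card_le_card h₁

end Counting

/-! ### Chebyshev's inequality and the probability of typical data. -/

section Probability

variable {Ω : Type*} [MeasurableSpace Ω] {P : Measure Ω} [IsProbabilityMeasure P]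

/-- Chebyshev for one fixed set. It controls the number of true nulls in one region `D t₂`, where no
uniformity in `t` is needed. -/
lemma measure_centeredCount_le {E : Type*} [MeasurableSpace E] {μ : Measure E}
    [IsProbabilityMeasure μ] {Z : ℕ → Ω → E} (hZ : ∀ i, Measurable (Z i)) (hind : iIndepFun Z P)
    (hlaw : ∀ i, P.map (Z i) = μ) {n : ℕ} (hn : 0 < n) {B : Set E} (hB : MeasurableSet B)
    {δ : ℝ} (hδ : 0 < δ) :
    P.real {ω | n * δ ≤ |centeredCount μ n B (fun i => Z i ω)|} ≤ 1 / (n * δ ^ 2) := by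
  have hn' : (0 : ℝ) < n := by exact_mod_cast hn
  have hm : Measurable fun ω => centeredCount μ n B (fun i => Z i ω) :=
    (measurable_centeredCount n hB).comp (measurable_pi_lambda _ hZ)
  have hint : Integrable (fun ω => centeredCount μ n B (fun i => Z i ω) ^ 2) P := by
    refine Integrable.of_bound (hm.pow_const 2).aestronglyMeasurable ((n : ℝ) ^ 2)
      (ae_of_all _ fun ω => ?_)
    rw [Real.norm_eq_abs, abs_pow]
    exact pow_le_pow_left₀ (abs_nonneg _) (abs_centeredCount_le n B _) 2
  have h1 := mul_meas_ge_le_integral_of_nonneg (ae_of_all P fun ω => sq_nonneg _) hint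
    ((n * δ) ^ 2)
  have h2 := integral_sq_centeredCount_le hZ hind hlaw n hB
  have hset : {ω | n * δ ≤ |centeredCount μ n B (fun i => Z i ω)|} ⊆
      {ω | (n * δ) ^ 2 ≤ centeredCount μ n B (fun i => Z i ω) ^ 2} := by
    intro ω hω
    show (n * δ) ^ 2 ≤ centeredCount μ n B (fun i => Z i ω) ^ 2
    rw [← sq_abs (centeredCount μ n B _)]
    exact pow_le_pow_left₀ (by positivity) hω 2
  have h3 := measureReal_mono (μ := P) hset (measure_ne_top _ _)
  rw [le_div_iff₀ (by positivity)]
  have h4 : (n * δ) ^ 2 * P.real {ω | n * δ ≤ |centeredCount μ n B (fun i => Z i ω)|} ≤ n :=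
    (mul_le_mul_of_nonneg_left h3 (sq_nonneg _)).trans (h1.trans h2)
  refine le_of_mul_le_mul_left ?_ hn'
  linarith

variable {d L : ℕ} {I : Set ℝ} {D : ℝ → Set (Obs d)} {F : Fin L → Measure (Obs d)}
  [∀ k, IsProbabilityMeasure (F k)] {G : Measure (Obs d)} [IsProbabilityMeasure G]
  {ν : Fin L → ℝ} {a : ℝ} {η : ℕ → Ω → Fin L ⊕ Unit} {X : ℕ → Ω → Obs d}

omit [IsProbabilityMeasure P] in
lemma IsRegularModel.ae_notMem_core (hM : IsRegularModel I D F G ν a)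
    (hX : IsMixtureSample P F G ν a η X) : ∀ᵐ ω ∂P, ∀ i, X i ω ∉ ⋂ t ∈ I, D t := by
  refine ae_all_iff.2 fun i => ?_
  have h : ∀ᵐ x ∂(P.map (X i)), x ∉ ⋂ t ∈ I, D t := by
    rw [hX.map_obs i]
    exact measure_eq_zero_iff_ae_notMem.1 hM.obsLaw_core
  exact ae_of_ae_map (hX.measurable_obs i).aemeasurable h

/-- The data are typical with probability tending to one. -/
lemma IsRegularModel.tendsto_measure_not_typical (hM : IsRegularModel I D F G ν a)
    (hX : IsMixtureSample P F G ν a η X) {ε : ℕ → ℝ} (hε : ∀ n, 0 ≤ ε n)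
    (hεn : Tendsto (fun n : ℕ => (n : ℝ) * ε n ^ 2) atTop atTop) {ρ : ℝ} (hρ : 0 < ρ) :
    Tendsto (fun n => P {ω | ¬ IsTypical I D (popCdf I D F G ν a) (ρ * ε n) (fun i => X i ω) n})
      atTop (𝓝 0) := by
  have hprob := hM.isProbabilityMeasure_obsLaw
  have hcont : ContinuousOn (fun t => (obsLaw F G ν a).real (D t)) I :=
    hM.continuousOn_popCdf.congr fun t ht => (hM.popCdf_eq ht).symm
  -- This is `8 / (n * γ ^ 2)` for `γ = ρ * ε n / 2`, the choice for which `2 * γ` is the allowed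
  -- deviation.
  have hlim : Tendsto (fun n : ℕ => ENNReal.ofReal (32 / ρ ^ 2 * (n * ε n ^ 2)⁻¹)) atTop
      (𝓝 0) := by
    rw [← ENNReal.ofReal_zero]
    refine ENNReal.tendsto_ofReal ?_
    simpa using hεn.inv_tendsto_atTop.const_mul (32 / ρ ^ 2)
  refine tendsto_of_tendsto_of_tendsto_of_le_of_le' tendsto_const_nhds hlim
    (Eventually.of_forall fun _ => zero_le) ?_
  filter_upwards [hεn.eventually_gt_atTop 0] with n hn
  have hn0 : 0 < n := by
    rcases Nat.eq_zero_or_pos n with h | h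
    · simp [h] at hn
    · exact h
  have hεpos : 0 < ε n := by
    rcases (hε n).eq_or_lt with h | h
    · simp [← h] at hn
    · exact h
  have hdev := measure_deviation_le hM.family hM.isOpen hM.ordConnected hM.nonempty
    hM.obsLaw_core hcont hX.measurable_obs hX.indep_obs hX.map_obs hn0
    (γ := ρ * ε n / 2) (by positivity)
  have hsub : {ω | ¬ IsTypical I D (popCdf I D F G ν a) (ρ * ε n) (fun i => X i ω) n} ⊆
      {ω | ¬ ∀ i, X i ω ∉ ⋂ t ∈ I, D t} ∪ {ω | ∃ t ∈ I, 2 * (ρ * ε n / 2) <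
        |empCdf D (fun i => X i ω) n t - (obsLaw F G ν a).real (D t)|} := by
    intro ω hω
    by_contra hcon
    rw [Set.mem_union, not_or] at hcon
    have h1 : ∀ i, X i ω ∉ ⋂ t ∈ I, D t := not_not.1 hcon.1
    refine hω ⟨h1, fun t ht => ?_⟩
    by_contra hlt
    refine hcon.2 ⟨t, ht, ?_⟩
    rw [hM.popCdf_eq ht, not_le] at hlt
    linarith
  refine (measure_mono hsub).trans ((measure_union_le _ _).trans ?_)
  rw [show P {ω | ¬ ∀ i, X i ω ∉ ⋂ t ∈ I, D t} = 0 from hM.ae_notMem_core hX, zero_add]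
  rw [← ofReal_measureReal]
  refine ENNReal.ofReal_le_ofReal (hdev.trans_eq ?_)
  field_simp
  ring

end Probability

/-! ### The false discovery rate, the cutoff and the comparison with the threshold rule. -/

section Main

variable {Ω : Type*} [MeasurableSpace Ω] {P : Measure Ω} [IsProbabilityMeasure P]
  {d L : ℕ} {I : Set ℝ} {D : ℝ → Set (Obs d)} {F : Fin L → Measure (Obs d)}
  [∀ k, IsProbabilityMeasure (F k)] {G : Measure (Obs d)} [IsProbabilityMeasure G]
  {ν : Fin L → ℝ} {a : ℝ} {η : ℕ → Ω → Fin L ⊕ Unit} {X : ℕ → Ω → Obs d}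

lemma IsRegularModel.integrable_fdp (hM : IsRegularModel I D F G ν a)
    (hX : IsMixtureSample P F G ν a η X) {α : ℝ} (hα : 0 < α) (e : ℝ) {T : Finset ℝ}
    (hT : (T : Set ℝ) ⊆ I) (n : ℕ) :
    Integrable (fun ω => fdp (fun i => η i ω) (rejected I D F α e T (fun i => X i ω) n)) P := by
  obtain ⟨S, hSn, hS, heq⟩ := exists_measurable_rejected hM.family hM.isOpen hM.ordConnected
    hM.continuous_level hα e hT hX.measurable_obs n
  have hm := measurable_fdp hX.measurable_id hSn hS
  have hint : Integrable (fun ω => fdp (fun i => η i ω) (S ω)) P := by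
    refine Integrable.of_bound hm.aestronglyMeasurable 1 (ae_of_all _ fun ω => ?_)
    rw [Real.norm_eq_abs, abs_of_nonneg (fdp_nonneg _ _)]
    exact fdp_le_one _ _
  refine hint.congr ?_
  filter_upwards [hM.ae_notMem_core hX] with ω hω
  rw [heq ω hω]

/-- The integral of a function with values in `[0, 1]` that is at most `b` off a set `A`. -/
lemma integral_le_add_measureReal {f : Ω → ℝ} (hf : Integrable f P) (h1 : ∀ ω, f ω ≤ 1) {b : ℝ}
    (hb : 0 ≤ b) {A : Set Ω} (hA : ∀ ω, ω ∉ A → f ω ≤ b) : ∫ ω, f ω ∂P ≤ b + P.real A := by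
  -- The bad events quantify over uncountably many `t` and are not assumed measurable, so `A` is
  -- enlarged to a measurable hull of the same measure.
  have hmA := measurableSet_toMeasurable P A
  calc ∫ ω, f ω ∂P ≤ ∫ ω, (b + (toMeasurable P A).indicator (fun _ => (1 : ℝ)) ω) ∂P := by
        refine integral_mono hf ((integrable_const _).add ((integrable_const _).indicator hmA)) ?_
        intro ω
        by_cases h : ω ∈ toMeasurable P A
        · simp only [Set.indicator_of_mem h]
          linarith [h1 ω]
        · simp only [Set.indicator_of_notMem h, add_zero]
          exact hA ω fun h' => h (subset_toMeasurable P A h')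
    _ = b + P.real A := by
        rw [integral_add (integrable_const _) ((integrable_const _).indicator hmA),
          integral_indicator_const _ hmA]
        simp [Measure.real, measure_toMeasurable]

variable {α : ℝ} {ε : ℕ → ℝ} {T : ℕ → Finset ℝ} {tstar : ℝ}

lemma IsRegularModel.limsup_fdr_le (hM : IsRegularModel I D F G ν a)
    (hX : IsMixtureSample P F G ν a η X) (hα : α ∈ Set.Ioo (0 : ℝ) 1) (hε : ∀ n, 0 ≤ ε n)
    (hTI : ∀ n, (T n : Set ℝ) ⊆ I) (hε0 : Tendsto ε atTop (𝓝 0))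
    (hεn : Tendsto (fun n : ℕ => (n : ℝ) * ε n ^ 2) atTop atTop)
    (hT : IncreasinglyDense T I)
    (htstar : IsLUB {t | t ∈ I ∧ limitMax I D F G ν a t ≤ α * popCdf I D F G ν a t} tstar)
    (htstarI : tstar ∈ I)
    (hA : ∃ t₀ < tstar, ∀ t ∈ Set.Ioo t₀ tstar, t ∈ I →
      limitMax I D F G ν a t < α * popCdf I D F G ν a t) :
    limsup (fun n : ℕ => ∫ ω, fdp (fun i => η i ω)
      (rejected I D F α (ε n) (T n) (fun i => X i ω) n) ∂P) atTop ≤ α := by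
  have hmix := isProbabilityMeasure_mixtureLaw (F := F) (G := G) hM.prior_nonneg hM.prior_sum
    hM.frac_mem
  have hα0 := hα.1
  have hρ : 0 < (1 - α) / 16 := by linarith [hα.2]
  have hQstar : 0 < popCdf I D F G ν a tstar := by
    obtain ⟨t₁, h1I, -, -, -, h1, -, -, hQ, -⟩ :=
      hM.eventually_cutoff_mem hα hε hTI hε0 hT htstar htstarI hA one_pos
    exact hQ.trans_le (hM.monotoneOn_popCdf h1I htstarI h1.le)
  have htrue := hM.true_le_at_tstar htstar htstarI htstar.nonempty
  refine le_of_forall_pos_le_add fun κ hκ => ?_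
  refine limsup_le_of_le (isCoboundedUnder_le_of_le (x := 0) atTop fun n =>
    integral_nonneg fun ω => fdp_nonneg _ _) ?_
  -- Half of `κ` is for the ratio on good data, the other half for the probabilities of the two bad
  -- events.
  set κ' := κ / 2 with hκ'
  have hκ'0 : 0 < κ' := half_pos hκ
  -- Numerator and denominator each lose `δ` to continuity near `t_*` and `δ` to sampling error. The
  -- equation says `α Q(t_*) + 2δ = (α + κ') (Q(t_*) - 2δ)`.
  obtain ⟨δ, hδ, hδeq⟩ : ∃ δ > 0, 2 * δ * (1 + (α + κ')) = κ' * popCdf I D F G ν a tstar :=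
    ⟨κ' * popCdf I D F G ν a tstar / (2 * (1 + (α + κ'))), by positivity, by field_simp⟩
  obtain ⟨r, hr, hclose⟩ := Metric.eventually_nhds_iff.1
    ((((hM.continuous_comb ν).continuousAt (x := tstar)).eventually
      (Metric.ball_mem_nhds _ hδ)).and
      ((hM.continuousAt_popCdf htstarI).eventually (Metric.ball_mem_nhds _ hδ)))
  simp only [Real.dist_eq] at hclose
  obtain ⟨t₁, h1I, t₂, h2I, h1r, h1, h2, h2r, hQ1, hev⟩ :=
    hM.eventually_cutoff_mem hα hε hTI hε0 hT htstar htstarI hA hr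
  have hc1 := (hclose (y := t₁) (by rw [abs_lt]; constructor <;> linarith)).2
  have hc2 := (hclose (y := t₂) (by rw [abs_lt]; constructor <;> linarith)).1
  rw [abs_lt] at hc1 hc2
  have hkey : (1 - a) * comb I D F ν t₂ + δ ≤ (α + κ') * (popCdf I D F G ν a t₁ - δ) := by
    have ha := hM.frac_mem
    have e1 : (1 - a) * comb I D F ν t₂ ≤ (1 - a) * comb I D F ν tstar + δ := by
      nlinarith [ha.1, ha.2]
    have e2 : (α + κ') * (popCdf I D F G ν a tstar - 2 * δ) ≤
        (α + κ') * (popCdf I D F G ν a t₁ - δ) :=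
      mul_le_mul_of_nonneg_left (by linarith) (by linarith)
    linarith
  let B : Set ((Fin L ⊕ Unit) × Obs d) := {l | l.isLeft} ×ˢ D t₂
  have hB : MeasurableSet B :=
    (measurableSet_sum_iff.2 ⟨.of_discrete, .of_discrete⟩).prod (hM.family.measurableSet t₂ h2I)
  have hBreal : (mixtureLaw F G ν a).real B = (1 - a) * comb I D F ν t₂ := by
    rw [mixtureLaw_isLeft_prod hM.prior_nonneg hM.frac_mem, comb_of_mem _ h2I]
  let bad₁ : ℕ → Set Ω := fun n =>
    {ω | ¬ IsTypical I D (popCdf I D F G ν a) ((1 - α) / 16 * ε n) (fun i => X i ω) n}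
  let bad₂ : ℕ → Set Ω := fun n =>
    {ω | n * δ ≤ |centeredCount (mixtureLaw F G ν a) n B (fun i => (η i ω, X i ω))|}
  have hbad₁ : Tendsto (fun n => P.real (bad₁ n)) atTop (𝓝 0) := by
    have h := (ENNReal.tendsto_toReal ENNReal.zero_ne_top).comp
      (hM.tendsto_measure_not_typical hX hε hεn hρ)
    rwa [ENNReal.toReal_zero] at h
  have hinv : Tendsto (fun n : ℕ => 1 / (n * δ ^ 2)) atTop (𝓝 0) := by
    have : Tendsto (fun n : ℕ => (n : ℝ) * δ ^ 2) atTop atTop :=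
      tendsto_natCast_atTop_atTop.atTop_mul_const (by positivity)
    simpa only [one_div] using! this.inv_tendsto_atTop
  filter_upwards [hev, hbad₁.eventually (gt_mem_nhds (half_pos hκ'0)),
    hinv.eventually (gt_mem_nhds (half_pos hκ'0)), hε0.eventually (gt_mem_nhds hδ),
    eventually_gt_atTop 0] with n hn hn1 hn2 hεδ hn0
  have hn' : (0 : ℝ) < n := by exact_mod_cast hn0
  have hb2 : P.real (bad₂ n) ≤ 1 / (n * δ ^ 2) :=
    measure_centeredCount_le hX.measurable_pair hX.indep hX.law hn0 hB hδ
  have hmain := integral_le_add_measureReal (P := P) (b := α + κ') (A := bad₁ n ∪ bad₂ n)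
    (hM.integrable_fdp hX hα0 (ε n) (hTI n) n) (fun ω => fdp_le_one _ _) (by linarith) ?_
  · have := measureReal_union_le (μ := P) (bad₁ n) (bad₂ n)
    linarith
  · intro ω hω
    rw [Set.mem_union, not_or] at hω
    have htyp : IsTypical I D (popCdf I D F G ν a) ((1 - α) / 16 * ε n) (fun i => X i ω) n :=
      not_not.1 hω.1
    obtain ⟨hne, hle1, hle2⟩ := hn _ htyp
    refine fdp_le (x := fun i => X i ω) (n := n)
      (indicesIn_subset_rejected hM.family hM.ordConnected htyp.1 h1I hne hle1)
      (rejected_subset_indicesIn hM.family hM.ordConnected htyp.1 h2I hle2) (by linarith) ?_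
    have hcc : |centeredCount (mixtureLaw F G ν a) n B (fun i => (η i ω, X i ω))| < n * δ :=
      not_le.1 hω.2
    have hcc' := (abs_lt.1 hcc).2
    rw [centeredCount, Finset.sum_sub_distrib, hBreal] at hcc'
    simp only [Finset.sum_const, Finset.card_range, nsmul_eq_mul] at hcc'
    have hF := (abs_le.1 (htyp.2 t₁ h1I)).1
    have hcount : (countIn D (fun i => X i ω) n t₁ : ℝ) = n * empCdf D (fun i => X i ω) n t₁ := by
      rw [empCdf, mul_div_cancel₀ _ hn'.ne']
    rw [hcount]
    have h3 : (1 - α) / 16 * ε n ≤ δ := by nlinarith [hε n, hα.2]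
    have h4 : (α + κ') * (popCdf I D F G ν a t₁ - δ) ≤
        (α + κ') * empCdf D (fun i => X i ω) n t₁ :=
      mul_le_mul_of_nonneg_left (by linarith) (by linarith)
    have h5 := mul_le_mul_of_nonneg_left (hkey.trans h4) hn'.le
    linarith

lemma IsRegularModel.tendsto_measure_cutoff (hM : IsRegularModel I D F G ν a)
    (hX : IsMixtureSample P F G ν a η X) (hα : α ∈ Set.Ioo (0 : ℝ) 1) (hε : ∀ n, 0 ≤ ε n)
    (hTI : ∀ n, (T n : Set ℝ) ⊆ I) (hε0 : Tendsto ε atTop (𝓝 0))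
    (hεn : Tendsto (fun n : ℕ => (n : ℝ) * ε n ^ 2) atTop atTop)
    (hT : IncreasinglyDense T I)
    (htstar : IsLUB {t | t ∈ I ∧ limitMax I D F G ν a t ≤ α * popCdf I D F G ν a t} tstar)
    (htstarI : tstar ∈ I)
    (hA : ∃ t₀ < tstar, ∀ t ∈ Set.Ioo t₀ tstar, t ∈ I →
      limitMax I D F G ν a t < α * popCdf I D F G ν a t) {r : ℝ} (hr : 0 < r) :
    Tendsto (fun n : ℕ => P {ω |
      ¬ (((tstar - r : ℝ) : EReal) < cutoff I D F α (ε n) (T n) (fun i => X i ω) n ∧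
        cutoff I D F α (ε n) (T n) (fun i => X i ω) n < ((tstar + r : ℝ) : EReal))})
      atTop (𝓝 0) := by
  have hρ : 0 < (1 - α) / 16 := by linarith [hα.2]
  obtain ⟨t₁, h1I, t₂, h2I, h1r, h1, h2, h2r, hQ1, hev⟩ :=
    hM.eventually_cutoff_mem hα hε hTI hε0 hT htstar htstarI hA hr
  refine tendsto_of_tendsto_of_tendsto_of_le_of_le' tendsto_const_nhds
    (hM.tendsto_measure_not_typical hX hε hεn hρ) (Eventually.of_forall fun _ => zero_le) ?_
  filter_upwards [hev] with n hn
  refine measure_mono fun ω hω htyp => hω ?_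
  obtain ⟨-, hle1, hle2⟩ := hn _ htyp
  exact ⟨(EReal.coe_lt_coe_iff.2 h1r).trans_le hle1, hle2.trans_lt (EReal.coe_lt_coe_iff.2 h2r)⟩

lemma IsRegularModel.tendstoInMeasure_symmDiff (hM : IsRegularModel I D F G ν a)
    (hX : IsMixtureSample P F G ν a η X) (hα : α ∈ Set.Ioo (0 : ℝ) 1) (hε : ∀ n, 0 ≤ ε n)
    (hTI : ∀ n, (T n : Set ℝ) ⊆ I) (hε0 : Tendsto ε atTop (𝓝 0))
    (hεn : Tendsto (fun n : ℕ => (n : ℝ) * ε n ^ 2) atTop atTop)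
    (hT : IncreasinglyDense T I)
    (htstar : IsLUB {t | t ∈ I ∧ limitMax I D F G ν a t ≤ α * popCdf I D F G ν a t} tstar)
    (htstarI : tstar ∈ I)
    (hA : ∃ t₀ < tstar, ∀ t ∈ Set.Ioo t₀ tstar, t ∈ I →
      limitMax I D F G ν a t < α * popCdf I D F G ν a t) :
    TendstoInMeasure P (fun (n : ℕ) ω =>
      ((symmDiff (rejected I D F α (ε n) (T n) (fun i => X i ω) n)
        (rejectedAt I D tstar (fun i => X i ω) n)).card : ℝ) /
      ((max (rejectedAt I D tstar (fun i => X i ω) n).card 1 : ℕ) : ℝ))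
      atTop (fun _ => 0) := by
  have hρ : 0 < (1 - α) / 16 := by linarith [hα.2]
  rw [tendstoInMeasure_iff_dist]
  intro κ hκ
  set q := popCdf I D F G ν a tstar with hq
  have hQstar : 0 < q := by
    obtain ⟨t₁, h1I, -, -, -, h1, -, -, hQ, -⟩ :=
      hM.eventually_cutoff_mem hα hε hTI hε0 hT htstar htstarI hA one_pos
    exact hQ.trans_le (hM.monotoneOn_popCdf h1I htstarI h1.le)
  -- The empirical increment from `t₁` to `t₂` stays below `4 * δ`, half from continuity and half
  -- from sampling. The equation gives `κ * (q - δ) = 5 * δ`, so one `δ` is to spare.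
  obtain ⟨δ, hδ, hδeq⟩ : ∃ δ > 0, δ * (5 + κ) = κ * q :=
    ⟨κ * q / (5 + κ), by positivity, by field_simp⟩
  obtain ⟨r, hr, hclose⟩ := Metric.eventually_nhds_iff.1
    ((hM.continuousAt_popCdf htstarI).eventually (Metric.ball_mem_nhds _ hδ))
  simp only [Real.dist_eq] at hclose
  obtain ⟨t₁, h1I, t₂, h2I, h1r, h1, h2, h2r, hQ1, hev⟩ :=
    hM.eventually_cutoff_mem hα hε hTI hε0 hT htstar htstarI hA hr
  have hc1 := hclose (y := t₁) (by rw [abs_lt]; constructor <;> linarith)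
  have hc2 := hclose (y := t₂) (by rw [abs_lt]; constructor <;> linarith)
  rw [abs_lt] at hc1 hc2
  refine tendsto_of_tendsto_of_tendsto_of_le_of_le' tendsto_const_nhds
    (hM.tendsto_measure_not_typical hX hε hεn hρ) (Eventually.of_forall fun _ => zero_le) ?_
  filter_upwards [hev, hε0.eventually (gt_mem_nhds hδ), eventually_gt_atTop 0] with n hn hεδ hn0
  have hn' : (0 : ℝ) < n := by exact_mod_cast hn0
  refine measure_mono fun ω hω htyp => ?_
  obtain ⟨hne, hle1, hle2⟩ := hn _ htyp
  have hRA := rejectedAt_eq hM.family hM.ordConnected htyp.1 n htstarI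
  have hmono : ∀ {s t}, s ∈ I → t ∈ I → s ≤ t →
      indicesIn D (fun i => X i ω) n s ⊆ indicesIn D (fun i => X i ω) n t := by
    intro s t hs ht hst i hi
    rw [mem_indicesIn] at hi ⊢
    exact ⟨hi.1, hM.family.mono s hs t ht hst hi.2⟩
  have hcard := card_symmDiff_le
    (indicesIn_subset_rejected hM.family hM.ordConnected htyp.1 h1I hne hle1)
    (rejected_subset_indicesIn hM.family hM.ordConnected htyp.1 h2I hle2)
    (hRA ▸ hmono h1I htstarI h1.le) (hRA ▸ hmono htstarI h2I h2.le)
  rw [card_indicesIn, card_indicesIn] at hcard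
  have hcount : ∀ t, (countIn D (fun i => X i ω) n t : ℝ) =
      n * empCdf D (fun i => X i ω) n t := fun t => by
    rw [empCdf, mul_div_cancel₀ _ hn'.ne']
  have hω' : κ ≤ dist (((symmDiff (rejected I D F α (ε n) (T n) (fun i => X i ω) n)
        (rejectedAt I D tstar (fun i => X i ω) n)).card : ℝ) /
      ((max (rejectedAt I D tstar (fun i => X i ω) n).card 1 : ℕ) : ℝ)) 0 := hω
  rw [Real.dist_0_eq_abs, abs_of_nonneg (by positivity), le_div_iff₀ (by positivity)] at hω'
  have hden : (countIn D (fun i => X i ω) n tstar : ℝ) ≤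
      ((max (rejectedAt I D tstar (fun i => X i ω) n).card 1 : ℕ) : ℝ) := by
    rw [hRA, card_indicesIn]
    exact Nat.cast_le.2 (le_max_left _ _)
  have hden' := mul_le_mul_of_nonneg_left hden hκ.le
  have hall := hden'.trans (hω'.trans hcard)
  rw [hcount, hcount, hcount] at hall
  have h3 : (1 - α) / 16 * ε n < δ := by nlinarith [hε n, hα.1]
  have hF1 := (abs_le.1 (htyp.2 t₁ h1I)).1
  have hF2 := (abs_le.1 (htyp.2 t₂ h2I)).2
  have hF3 := (abs_le.1 (htyp.2 tstar htstarI)).1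
  have hlt : empCdf D (fun i => X i ω) n t₂ - empCdf D (fun i => X i ω) n t₁ <
      κ * empCdf D (fun i => X i ω) n tstar := by
    have : κ * (q - δ) ≤ κ * empCdf D (fun i => X i ω) n tstar :=
      mul_le_mul_of_nonneg_left (by linarith) hκ.le
    linarith
  have := mul_lt_mul_of_pos_left hlt hn'
  linarith

end Main

end CompositeNull

theorem mainTheorem2 {Ω : Type*} [MeasurableSpace Ω] (P : Measure Ω) [IsProbabilityMeasure P]
    {d L : ℕ}
    -- the index interval and the rejection regions
    (I : Set ℝ) (hIopen : IsOpen I) (hIconn : I.OrdConnected) (hIne : I.Nonempty)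
    (D : ℝ → Set (CompositeNull.Obs d)) (hD : CompositeNull.IsRegionFamily I D)
    -- null distributions, distribution under false nulls, prior, fraction of false nulls
    (F : Fin L → Measure (CompositeNull.Obs d)) [∀ k, IsProbabilityMeasure (F k)]
    (G : Measure (CompositeNull.Obs d)) [IsProbabilityMeasure G]
    (hDF : ∀ k, F k (⋂ t ∈ I, D t) = 0) (hDG : G (⋂ t ∈ I, D t) = 0)
    (ν : Fin L → ℝ) (hν : ∀ k, 0 ≤ ν k) (hνsum : ∑ k, ν k = 1)
    (a : ℝ) (ha : a ∈ Set.Ioo (0 : ℝ) 1)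
    -- the data
    (η : ℕ → Ω → Fin L ⊕ Unit) (X : ℕ → Ω → CompositeNull.Obs d)
    (hX : CompositeNull.IsMixtureSample P F G ν a η X)
    -- control parameter, margins and grids
    (α : ℝ) (hα : α ∈ Set.Ioo (0 : ℝ) 1)
    (ε : ℕ → ℝ) (hε : ∀ n, 0 ≤ ε n)
    (T : ℕ → Finset ℝ) (hTI : ∀ n, (T n : Set ℝ) ⊆ I)
    -- regularity of the levels
    (hφ : ∀ k, Continuous (CompositeNull.level I D (F k)))
    (hφmono : ∃ c ∈ CompositeNull.Delta L, StrictMonoOn (CompositeNull.comb I D F c) I)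
    (hG : ContinuousOn (fun t => G.real (D t)) I)
    -- asymptotics of the margins and grids
    (hε0 : Tendsto ε atTop (𝓝 0))
    (hεn : Tendsto (fun n : ℕ => (n : ℝ) * ε n ^ 2) atTop atTop)
    (hT : CompositeNull.IncreasinglyDense T I)
    -- the threshold `t_*` and Assumption A
    (tstar : ℝ)
    (htstar : IsLUB {t | t ∈ I ∧ CompositeNull.limitMax I D F G ν a t ≤
      α * CompositeNull.popCdf I D F G ν a t} tstar)
    (htstarI : tstar ∈ I)
    (hA : ∃ t₀ < tstar, ∀ t ∈ Set.Ioo t₀ tstar, t ∈ I →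
      CompositeNull.limitMax I D F G ν a t < α * CompositeNull.popCdf I D F G ν a t) :
    -- the false discovery proportion has a genuine expectation
    (∀ n, Integrable (fun ω => CompositeNull.fdp (fun i => η i ω)
      (CompositeNull.rejected I D F α (ε n) (T n) (fun i => X i ω) n)) P) ∧
    -- asymptotic control of the false discovery rate
    limsup (fun n : ℕ => ∫ ω, CompositeNull.fdp (fun i => η i ω)
      (CompositeNull.rejected I D F α (ε n) (T n) (fun i => X i ω) n) ∂P) atTop ≤ α ∧
    -- the cutoff converges to `t_*` in probability
    (∀ r : ℝ, 0 < r → Tendsto (fun n : ℕ => P {ω |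
      ¬ (((tstar - r : ℝ) : EReal) < CompositeNull.cutoff I D F α (ε n) (T n) (fun i => X i ω) n ∧
        CompositeNull.cutoff I D F α (ε n) (T n) (fun i => X i ω) n < ((tstar + r : ℝ) : EReal))})
      atTop (𝓝 0)) ∧
    -- the hypotheses on which the procedure and the threshold rule `s_i ≤ t_*` disagree are
    -- a vanishing fraction of those which the threshold rule rejects, in probability
    TendstoInMeasure P (fun (n : ℕ) ω =>
      ((symmDiff (CompositeNull.rejected I D F α (ε n) (T n) (fun i => X i ω) n)
        (CompositeNull.rejectedAt I D tstar (fun i => X i ω) n)).card : ℝ) /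
      ((max (CompositeNull.rejectedAt I D tstar (fun i => X i ω) n).card 1 : ℕ) : ℝ))
      atTop (fun _ => 0) := by
  have hM : CompositeNull.IsRegularModel I D F G ν a :=
    ⟨hIopen, hIconn, hIne, hD, hDF, hDG, hν, hνsum, ha, hφ, hG⟩
  exact ⟨fun n => hM.integrable_fdp hX hα.1 (ε n) (hTI n) n,
    hM.limsup_fdr_le hX hα hε hTI hε0 hεn hT htstar htstarI hA,
    fun r hr => hM.tendsto_measure_cutoff hX hα hε hTI hε0 hεn hT htstar htstarI hA hr,
    hM.tendstoInMeasure_symmDiff hX hα hε hTI hε0 hεn hT htstar htstarI hA⟩
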